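/- Let $d\ge 1$, let $\Omega\subset\mathbb{R}^d$ be open, let $1<p<\infty$, let $k\ge 1$, and let $g_1,\dots,g_k\in W^{1,p}(\Omega)$. Let $K$ be the set of all tuples $V=(v_1,\dots,v_k)$ with $v_i\in W^{1,p}(\Omega)$, $v_i\ge 0$ a.e. in $\Omega$, $v_i v_j=0$ a.e. in $\Omega$ for $i\ne j$, and $v_i=g_i$ on $\partial\Omega$ in the sense that $v_i-g_i\in W^{1,p}_0(\Omega)$. Let $U=(u_1,\dots,u_k)\in K$ minimize $$J(V)=\frac1p\int_\Omega\sum_{i=1}^k|\nabla v_i|^p\,dx$$ over $K$, and put $\hat u_i=u_i-\sum_{j\ne i}u_j$. Then for every $i=1,\dots,k$ and every $\varphi\in C_c^\infty(\Omega)$ with $\varphi\ge0$: 1. $-\Delta_p u_i\le 0$ weakly in $\Omega$, that is, $\int_\Omega|\nabla u_i|^{p-2}\nabla u_i\cdot\nabla\varphi\,dx\le 0$; 2. $-\Delta_p\hat u_i\ge 0$ weakly in $\Omega$, that is, $\int_\Omega|\nabla\hat u_i|^{p-2}\nabla\hat u_i\cdot\nabla\varphi\,dx\ge 0$. -/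

import Mathlib

open MeasureTheory
open scoped ContDiff ENNReal

noncomputable section

/-- `φ ∈ C_c^∞(Ω)`: a smooth real function whose compact support is contained in `Ω`. -/
def IsTestFunction {d : ℕ} (Ω : Set (EuclideanSpace ℝ (Fin d)))
    (φ : EuclideanSpace ℝ (Fin d) → ℝ) : Prop :=
  ContDiff ℝ ∞ φ ∧ HasCompactSupport φ ∧ tsupport φ ⊆ Ω

/-- `G` is a weak (distributional) gradient of `u` in `Ω`:
`∫_Ω u ∂_v φ = - ∫_Ω φ ⟨G, v⟩` for all test functions `φ` and all directions `v`. -/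
def HasWeakGradient {d : ℕ} (Ω : Set (EuclideanSpace ℝ (Fin d)))
    (u : EuclideanSpace ℝ (Fin d) → ℝ)
    (G : EuclideanSpace ℝ (Fin d) → EuclideanSpace ℝ (Fin d)) : Prop :=
  LocallyIntegrableOn u Ω ∧ LocallyIntegrableOn G Ω ∧
    ∀ φ : EuclideanSpace ℝ (Fin d) → ℝ, IsTestFunction Ω φ →
      ∀ v : EuclideanSpace ℝ (Fin d),
        ∫ x in Ω, u x * fderiv ℝ φ x v = -∫ x in Ω, φ x * inner ℝ (G x) v

open Classical in
/-- The weak gradient of `u` in `Ω` (unique up to null sets of the open set `Ω`),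
and `0` by convention if `u` has none. -/
def weakGradient {d : ℕ} (Ω : Set (EuclideanSpace ℝ (Fin d)))
    (u : EuclideanSpace ℝ (Fin d) → ℝ) :
    EuclideanSpace ℝ (Fin d) → EuclideanSpace ℝ (Fin d) :=
  if h : ∃ G, HasWeakGradient Ω u G then h.choose else 0

/-- `u ∈ W^{1,p}(Ω)`. -/
def MemW1p {d : ℕ} (Ω : Set (EuclideanSpace ℝ (Fin d))) (p : ℝ)
    (u : EuclideanSpace ℝ (Fin d) → ℝ) : Prop :=
  MemLp u (ENNReal.ofReal p) (volume.restrict Ω) ∧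
    ∃ G, HasWeakGradient Ω u G ∧ MemLp G (ENNReal.ofReal p) (volume.restrict Ω)

/-- `w ∈ W_0^{1,p}(Ω)`: the closure of `C_c^∞(Ω)` in `W^{1,p}(Ω)`. -/
def MemW1pZero {d : ℕ} (Ω : Set (EuclideanSpace ℝ (Fin d))) (p : ℝ)
    (w : EuclideanSpace ℝ (Fin d) → ℝ) : Prop :=
  MemW1p Ω p w ∧
    ∀ ε : ℝ≥0∞, 0 < ε → ∃ φ : EuclideanSpace ℝ (Fin d) → ℝ, IsTestFunction Ω φ ∧
      eLpNorm (fun x => w x - φ x) (ENNReal.ofReal p) (volume.restrict Ω) ≤ ε ∧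
      eLpNorm (fun x => weakGradient Ω w x - gradient φ x) (ENNReal.ofReal p)
        (volume.restrict Ω) ≤ ε

/-- The energy `J(u_1, …, u_k) = (1/p) ∫_Ω ∑ i, |∇u_i|^p`. -/
def segregationEnergy {d k : ℕ} (Ω : Set (EuclideanSpace ℝ (Fin d))) (p : ℝ)
    (u : Fin k → EuclideanSpace ℝ (Fin d) → ℝ) : ℝ :=
  (1 / p) * ∫ x in Ω, ∑ i, ‖weakGradient Ω (u i) x‖ ^ p

/-- The admissible tuples: components in `W^{1,p}(Ω)` which are nonnegative, pairwise segregated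
(`u_i u_j = 0` for `i ≠ j`), and satisfy `u_i = g_i` on `∂Ω`, i.e. `u_i - g_i ∈ W_0^{1,p}(Ω)`. -/
def segregatedClass {d k : ℕ} (Ω : Set (EuclideanSpace ℝ (Fin d))) (p : ℝ)
    (g : Fin k → EuclideanSpace ℝ (Fin d) → ℝ) :
    Set (Fin k → EuclideanSpace ℝ (Fin d) → ℝ) :=
  {u | (∀ i, MemW1p Ω p (u i)) ∧
    (∀ i, ∀ᵐ x ∂(volume.restrict Ω), 0 ≤ u i x) ∧
    (∀ i j, i ≠ j → ∀ᵐ x ∂(volume.restrict Ω), u i x * u j x = 0) ∧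
    ∀ i, MemW1pZero Ω p (fun x => u i x - g i x)}

/-- `-Δ_p u ≤ 0` weakly in `Ω`: `u ∈ W^{1,p}(Ω)` and
`∫_Ω |∇u|^{p-2} ∇u · ∇φ ≤ 0` for every nonnegative test function `φ`. -/
def IsWeaklyPSubharmonic {d : ℕ} (Ω : Set (EuclideanSpace ℝ (Fin d))) (p : ℝ)
    (u : EuclideanSpace ℝ (Fin d) → ℝ) : Prop :=
  MemW1p Ω p u ∧
    ∀ φ : EuclideanSpace ℝ (Fin d) → ℝ, IsTestFunction Ω φ → (∀ x, 0 ≤ φ x) →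
      ∫ x in Ω, ‖weakGradient Ω u x‖ ^ (p - 2) *
        inner ℝ (weakGradient Ω u x) (gradient φ x) ≤ 0

/-- `-Δ_p u ≥ 0` weakly in `Ω`: `u ∈ W^{1,p}(Ω)` and
`∫_Ω |∇u|^{p-2} ∇u · ∇φ ≥ 0` for every nonnegative test function `φ`. -/
def IsWeaklyPSuperharmonic {d : ℕ} (Ω : Set (EuclideanSpace ℝ (Fin d))) (p : ℝ)
    (u : EuclideanSpace ℝ (Fin d) → ℝ) : Prop :=
  MemW1p Ω p u ∧
    ∀ φ : EuclideanSpace ℝ (Fin d) → ℝ, IsTestFunction Ω φ → (∀ x, 0 ≤ φ x) →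
      0 ≤ ∫ x in Ω, ‖weakGradient Ω u x‖ ^ (p - 2) *
        inner ℝ (weakGradient Ω u x) (gradient φ x)

/-- `û_i = u_i - ∑_{j ≠ i} u_j`. -/
def hatComponent {d k : ℕ} (u : Fin k → EuclideanSpace ℝ (Fin d) → ℝ) (i : Fin k) :
    EuclideanSpace ℝ (Fin d) → ℝ :=
  fun x => u i x - ∑ j ∈ Finset.univ.erase i, u j x

end

/-! Both inequalities are first variations along one-sided competitors. For `t > 0` and a test
function `φ ≥ 0`, each competitor agrees with `u` off the support of `φ`, so it keeps the boundary
data (`mem_segregatedClass_of_eq_off_compact`).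

For the first inequality, replace `u i` by `(u i - tφ)⁺`. Shrinking one component preserves
segregation, and truncation discards gradient, so minimality gives `∫ |∇u i|^p ≤ ∫ |∇u i - t∇φ|^p`.

For the second, write `û` for `hatComponent u i` and take `(û + tφ)⁺` as component `i` and `(u j -
tφ)⁺` for `j ≠ i`. At almost every point at most one `u j` is nonzero, so the new components with `j
≠ i` add up to the negative part of `û + tφ`. Hence the tuple is segregated and its energy density
is exactly `|∇(û + tφ)|^p`, while that of `u` is `|∇û|^p`. Minimality becomes `∫ |∇û|^p ≤ ∫ |∇û +
t∇φ|^p`.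

In both cases `integral_norm_rpow_mul_inner_nonneg` differentiates at `t = 0⁺`. The pointwise energy
identities are `sum_norm_rpow_eq_of_segregated` and `sum_norm_rpow_competitor`; they rest on the
fact that a weak gradient vanishes a.e. on the zero set (`HasWeakGradient.ae_eq_zero_of_eq_zero`).
The Sobolev calculus needed for this (chain rule, positive parts, density of test functions) is
derived from mollification. -/

open Set Filter Metric ContinuousLinearMap
open scoped Topology Convolution Manifold

/-! ### Mollification in `L^q`. -/

section Mollification

variable {E F : Type*} [NormedAddCommGroup E] [NormedSpace ℝ E] [FiniteDimensional ℝ E]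
  [MeasurableSpace E] [BorelSpace E] {μ : Measure E} [μ.IsAddHaarMeasure]
  [NormedAddCommGroup F] [NormedSpace ℝ F]

/-- Averaging the translates of a function with respect to a probability measure does not
increase its `L^q` norm. -/
theorem eLpNorm_integral_translate_le {ν : Measure E} [IsProbabilityMeasure ν] (hν : ν ≪ μ)
    {q : ℝ≥0∞} (hq : 1 ≤ q) (hq' : q ≠ ⊤) {f : E → F} (hf : AEStronglyMeasurable f μ) :
    eLpNorm (fun x => ∫ t, f (x - t) ∂ν) q μ ≤ eLpNorm f q μ := by
  have hq0 : q ≠ 0 := (zero_lt_one.trans_le hq).ne'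
  have hr : 0 < q.toReal := ENNReal.toReal_pos hq0 hq'
  have hmeas : AEStronglyMeasurable (fun z : E × E => f (z.1 - z.2)) (μ.prod ν) :=
    hf.comp_quasiMeasurePreserving (quasiMeasurePreserving_sub_of_right_invariant μ ν)
  have hsec : ∀ x, AEStronglyMeasurable (fun t => f (x - t)) ν := fun x =>
    (hf.comp_quasiMeasurePreserving
      (quasiMeasurePreserving_sub_left_of_right_invariant μ x)).mono_ac hν
  -- Jensen's inequality for `|·|^q`, in the form that `L^q` norms over a probability measure
  -- increase with the exponent. Tonelli and translation invariance then finish the proof.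
  have hpt : ∀ x, ‖∫ t, f (x - t) ∂ν‖ₑ ^ q.toReal ≤ ∫⁻ t, ‖f (x - t)‖ₑ ^ q.toReal ∂ν := by
    intro x
    have h1 : ‖∫ t, f (x - t) ∂ν‖ₑ ≤ eLpNorm (fun t => f (x - t)) q ν := by
      refine (enorm_integral_le_lintegral_enorm _).trans ?_
      rw [← eLpNorm_one_eq_lintegral_enorm]
      exact eLpNorm_le_eLpNorm_of_exponent_le hq (hsec x)
    calc _ ≤ (eLpNorm (fun t => f (x - t)) q ν) ^ q.toReal := by gcongr
      _ = _ := by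
        rw [eLpNorm_eq_lintegral_rpow_enorm_toReal hq0 hq', ← ENNReal.rpow_mul,
          one_div, inv_mul_cancel₀ hr.ne', ENNReal.rpow_one]
  rw [eLpNorm_eq_lintegral_rpow_enorm_toReal hq0 hq',
    eLpNorm_eq_lintegral_rpow_enorm_toReal hq0 hq']
  refine ENNReal.rpow_le_rpow ?_ (by positivity)
  calc ∫⁻ x, ‖∫ t, f (x - t) ∂ν‖ₑ ^ q.toReal ∂μ
      ≤ ∫⁻ x, ∫⁻ t, ‖f (x - t)‖ₑ ^ q.toReal ∂ν ∂μ := lintegral_mono hpt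
    _ = ∫⁻ t, ∫⁻ x, ‖f (x - t)‖ₑ ^ q.toReal ∂μ ∂ν :=
        lintegral_lintegral_swap (hmeas.enorm.pow_const _)
    _ = ∫⁻ x, ‖f x‖ₑ ^ q.toReal ∂μ := by
        simp_rw [lintegral_sub_right_eq_self (μ := μ) (fun x => ‖f x‖ₑ ^ q.toReal)]
        simp

/-- The normalized bump is the density of a probability measure, so convolving with it averages
translates. -/
theorem ContDiffBump.eLpNorm_normed_convolution_le (φ : ContDiffBump (0 : E))
    {q : ℝ≥0∞} (hq : 1 ≤ q) (hq' : q ≠ ⊤) {f : E → F} (hf : AEStronglyMeasurable f μ) :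
    eLpNorm (φ.normed μ ⋆[lsmul ℝ ℝ, μ] f) q μ ≤ eLpNorm f q μ := by
  have hm : Measurable (fun x => ENNReal.ofReal (φ.normed μ x)) :=
    (φ.continuous_normed.measurable).ennreal_ofReal
  let ν := μ.withDensity fun x => ENNReal.ofReal (φ.normed μ x)
  have : IsProbabilityMeasure ν := ⟨by
    rw [withDensity_apply _ MeasurableSet.univ, Measure.restrict_univ,
      ← ofReal_integral_eq_lintegral_ofReal φ.integrable_normed
        (Eventually.of_forall φ.nonneg_normed), φ.integral_normed, ENNReal.ofReal_one]⟩
  convert eLpNorm_integral_translate_le (ν := ν) (withDensity_absolutelyContinuous _ _) hq hq' hf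
    using 2
  ext x
  rw [integral_withDensity_eq_integral_toReal_smul hm (by simp)]
  simp only [convolution_def, lsmul_apply, ENNReal.toReal_ofReal (φ.nonneg_normed _)]

/-- Mollifications of an `L^q` function converge to it in `L^q`. -/
theorem MeasureTheory.MemLp.exists_eLpNorm_normed_convolution_sub_le [CompleteSpace F] {q : ℝ≥0∞} (hq : 1 ≤ q)
    (hq' : q ≠ ⊤) {f : E → F} (hf : MemLp f q μ) {ε : ℝ≥0∞} (hε : ε ≠ 0) :
    ∃ δ > 0, ∀ φ : ContDiffBump (0 : E), φ.rOut < δ →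
      eLpNorm (φ.normed μ ⋆[lsmul ℝ ℝ, μ] f - f) q μ ≤ ε := by
  have hq0 : q ≠ 0 := (zero_lt_one.trans_le hq).ne'
  have hε3 : ε / 3 ≠ 0 := by simp [hε]
  obtain ⟨g, hgs, hfg, hgc, hgq⟩ := hf.exists_hasCompactSupport_eLpNorm_sub_le hq' hε3
  have hB : IsCompact (cthickening 1 (tsupport g)) := hgs.isCompact.cthickening
  -- A uniform error `η` supported in the 1-thickening of `tsupport g`, a set of finite measure,
  -- costs at most `ε / 3` in `L^q`.
  obtain ⟨η, hη, hηε⟩ : ∃ η : ℝ, 0 < η ∧ ENNReal.ofReal η *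
      μ (cthickening 1 (tsupport g)) ^ (1 / q.toReal) ≤ ε / 3 := by
    have hlim : Tendsto (fun η : ℝ => ENNReal.ofReal η *
        μ (cthickening 1 (tsupport g)) ^ (1 / q.toReal)) (𝓝[>] 0) (𝓝 (ENNReal.ofReal 0 *
        μ (cthickening 1 (tsupport g)) ^ (1 / q.toReal))) := by
      refine ENNReal.Tendsto.mul_const ?_ (Or.inr ?_)
      · exact (ENNReal.continuous_ofReal.tendsto 0).mono_left nhdsWithin_le_nhds
      · exact ENNReal.rpow_ne_top_of_nonneg (by positivity) hB.measure_lt_top.ne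
    rw [ENNReal.ofReal_zero, zero_mul] at hlim
    have h1 := hlim.eventually (ge_mem_nhds (pos_iff_ne_zero.2 hε3))
    obtain ⟨η, h2, h3⟩ := (h1.and self_mem_nhdsWithin).exists
    exact ⟨η, h3, h2⟩
  obtain ⟨δ, hδ, hgδ⟩ := Metric.uniformContinuous_iff.1
    (hgs.uniformContinuous_of_continuous hgc) η hη
  -- The cap `1` keeps the mollified `g` supported in the 1-thickening; `δ` is its modulus of
  -- uniform continuity for `η`.
  refine ⟨min δ 1, lt_min hδ one_pos, fun φ hφ => ?_⟩
  have hgl : LocallyIntegrable g μ := hgc.locallyIntegrable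
  have hfl : LocallyIntegrable f μ := hf.locallyIntegrable hq
  have hex : ∀ {h : E → F}, LocallyIntegrable h μ →
      ConvolutionExists (φ.normed μ) h (lsmul ℝ ℝ) μ := fun hh =>
    φ.hasCompactSupport_normed.convolutionExists_left _ φ.continuous_normed hh
  have hcont : ∀ {h : E → F}, LocallyIntegrable h μ →
      Continuous (φ.normed μ ⋆[lsmul ℝ ℝ, μ] h) := fun hh =>
    φ.hasCompactSupport_normed.continuous_convolution_left _ φ.continuous_normed hh
  -- The outer two terms are small because `g` is `L^q`-close to `f` and mollification is a
  -- contraction; the middle one is small uniformly.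
  have hdec : φ.normed μ ⋆[lsmul ℝ ℝ, μ] f - f =
      (φ.normed μ ⋆[lsmul ℝ ℝ, μ] (f - g)) + (φ.normed μ ⋆[lsmul ℝ ℝ, μ] g - g) + (g - f) := by
    have := (hex (hfl.sub hgl)).distrib_add (hex hgl)
    rw [sub_add_cancel] at this
    rw [this]; abel
  have h1 : eLpNorm (φ.normed μ ⋆[lsmul ℝ ℝ, μ] (f - g)) q μ ≤ ε / 3 :=
    (φ.eLpNorm_normed_convolution_le hq hq'
      (hf.aestronglyMeasurable.sub hgc.aestronglyMeasurable)).trans hfg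
  have h3 : eLpNorm (g - f) q μ ≤ ε / 3 := by rwa [eLpNorm_sub_comm]
  have h2 : eLpNorm (φ.normed μ ⋆[lsmul ℝ ℝ, μ] g - g) q μ ≤ ε / 3 := by
    refine (eLpNorm_sub_le_of_dist_bdd μ hq' hB.measurableSet hη.le (fun x => ?_) ?_ ?_).trans hηε
    · refine φ.dist_normed_convolution_le hgc.aestronglyMeasurable fun y hy => (hgδ ?_).le
      exact (mem_ball.1 hy).trans (hφ.trans_le (min_le_left _ _))
    · refine (support_convolution_subset _).trans ?_
      rw [φ.support_normed_eq]
      rintro _ ⟨a, ha, b, hb, rfl⟩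
      refine mem_cthickening_of_dist_le _ b _ _ (subset_tsupport _ hb) ?_
      have : dist a 0 < φ.rOut := ha
      simp only [dist_add_self_left, dist_zero_right] at this ⊢
      exact (this.trans (hφ.trans_le (min_le_right _ _))).le
    · exact (subset_tsupport g).trans (self_subset_cthickening _)
  rw [hdec]
  have hm1 := (hcont (hfl.sub hgl)).aestronglyMeasurable (μ := μ)
  have hm2 := (hcont hgl).aestronglyMeasurable (μ := μ).sub hgc.aestronglyMeasurable
  calc _ ≤ _ := eLpNorm_add_le (hm1.add hm2)
        (hgc.aestronglyMeasurable.sub hf.aestronglyMeasurable) hq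
    _ ≤ _ := add_le_add_left (eLpNorm_add_le hm1 hm2 hq) _
    _ ≤ ε / 3 + ε / 3 + ε / 3 := by gcongr
    _ = ε := ENNReal.add_thirds ε

end Mollification

/-! ### Smooth cutoffs. -/

/-- A smooth cutoff function equal to `1` near a compact subset of an open set. -/
theorem IsCompact.exists_contDiff_cutoff {E : Type*} [NormedAddCommGroup E]
    [NormedSpace ℝ E] [FiniteDimensional ℝ E] {K U : Set E} (hK : IsCompact K) (hU : IsOpen U)
    (hKU : K ⊆ U) :
    ∃ χ : E → ℝ, ContDiff ℝ ∞ χ ∧ HasCompactSupport χ ∧ tsupport χ ⊆ U ∧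
      (∀ x ∈ K, χ =ᶠ[𝓝 x] 1) ∧ ∀ x, χ x ∈ Icc (0 : ℝ) 1 := by
  obtain ⟨δ, hδ, hδU⟩ := hK.exists_cthickening_subset_open hU hKU
  have hB : IsCompact (cthickening δ K) := hK.cthickening
  obtain ⟨χ, h1, h0, hI⟩ := exists_contMDiffMap_one_nhds_of_subset_interior (n := ⊤) 𝓘(ℝ, E)
    hK.isClosed ((self_subset_thickening hδ K).trans
      (interior_maximal (thickening_subset_cthickening δ K) isOpen_thickening))
  have hs : tsupport χ ⊆ cthickening δ K :=
    closure_minimal (fun x hx => by_contra fun h => hx (h0 x h)) isClosed_cthickening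
  exact ⟨χ, χ.contMDiff.contDiff, HasCompactSupport.of_support_subset_isCompact hB
    ((subset_tsupport _).trans hs), hs.trans hδU,
    fun x hx => h1.filter_mono (nhds_le_nhdsSet hx), hI⟩

/-! ### Test functions and weak gradients: uniqueness, linearity, Leibniz rule, smooth
approximation. -/

section WeakGradient

variable {d : ℕ} {Ω : Set (EuclideanSpace ℝ (Fin d))}

theorem MeasureTheory.LocallyIntegrableOn.integrable_smul_of_tsupport_subset {F : Type*}
    [NormedAddCommGroup F] [NormedSpace ℝ F] {u : EuclideanSpace ℝ (Fin d) → F}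
    (hu : LocallyIntegrableOn u Ω) {ψ : EuclideanSpace ℝ (Fin d) → ℝ} (hψ : Continuous ψ)
    (hs : HasCompactSupport ψ) (hsub : tsupport ψ ⊆ Ω) : Integrable (fun x => ψ x • u x) := by
  have h := (hu.integrableOn_compact_subset hsub hs.isCompact).continuousOn_smul
    hψ.continuousOn hs.isCompact
  refine (integrableOn_iff_integrable_of_support_subset fun x hx => ?_).1 h
  exact subset_tsupport _ fun h0 => hx (by simp [h0])

theorem MeasureTheory.MemLp.locallyIntegrableOn {F : Type*} [NormedAddCommGroup F]
    {u : EuclideanSpace ℝ (Fin d) → F} {q : ℝ≥0∞} (hq : 1 ≤ q)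
    (hu : MemLp u q (volume.restrict Ω)) : LocallyIntegrableOn u Ω :=
  locallyIntegrableOn_of_locallyIntegrable_restrict (hu.locallyIntegrable hq)

theorem HasCompactSupport.fderiv_convolution_lsmul_apply {E : Type*} [NormedAddCommGroup E]
    [NormedSpace ℝ E] [FiniteDimensional ℝ E] [MeasurableSpace E] [BorelSpace E] {μ : Measure E}
    [μ.IsAddHaarMeasure] {η w : E → ℝ} (hηs : HasCompactSupport η) (hη : ContDiff ℝ 1 η)
    (hw : LocallyIntegrable w μ) (x v : E) :
    fderiv ℝ (η ⋆[lsmul ℝ ℝ, μ] w) x v = ∫ y, fderiv ℝ η (x - y) v * w y ∂μ := by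
  have hi := ((hηs.fderiv ℝ).convolutionExists_left ((lsmul ℝ ℝ).precompL E)
    (hη.continuous_fderiv one_ne_zero) hw x).integrable_swap
  rw [(hηs.hasFDerivAt_convolution_left (lsmul ℝ ℝ) hη hw x).fderiv, convolution_eq_swap,
    ContinuousLinearMap.integral_apply hi]
  simp only [precompL_apply, lsmul_apply, smul_eq_mul]

namespace IsTestFunction

variable {φ ψ : EuclideanSpace ℝ (Fin d) → ℝ}

theorem continuous (hφ : IsTestFunction Ω φ) : Continuous φ := hφ.1.continuous

theorem continuous_fderiv_apply (hφ : IsTestFunction Ω φ) (v : EuclideanSpace ℝ (Fin d)) :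
    Continuous fun x => fderiv ℝ φ x v :=
  (hφ.1.continuous_fderiv (by simp)).clm_apply continuous_const

theorem differentiable (hφ : IsTestFunction Ω φ) : Differentiable ℝ φ :=
  hφ.1.differentiable (by simp)

theorem eq_zero (hφ : IsTestFunction Ω φ) {x : EuclideanSpace ℝ (Fin d)} (hx : x ∉ Ω) :
    φ x = 0 :=
  image_eq_zero_of_notMem_tsupport fun h => hx (hφ.2.2 h)

theorem tsupport_fderiv_apply_subset (hφ : IsTestFunction Ω φ) (v : EuclideanSpace ℝ (Fin d)) :
    tsupport (fun x => fderiv ℝ φ x v) ⊆ Ω :=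
  (_root_.tsupport_fderiv_apply_subset ℝ v).trans hφ.2.2

theorem hasCompactSupport_fderiv_apply (hφ : IsTestFunction Ω φ)
    (v : EuclideanSpace ℝ (Fin d)) : HasCompactSupport fun x => fderiv ℝ φ x v :=
  hφ.2.1.fderiv_apply ℝ v

theorem fderiv_apply_eq_zero {x : EuclideanSpace ℝ (Fin d)}
    (hx : x ∉ tsupport φ) (v : EuclideanSpace ℝ (Fin d)) : fderiv ℝ φ x v = 0 :=
  image_eq_zero_of_notMem_tsupport (f := fun x => fderiv ℝ φ x v)
    fun h => hx (_root_.tsupport_fderiv_apply_subset ℝ v h)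

theorem gradient_eq_zero {x : EuclideanSpace ℝ (Fin d)}
    (hx : x ∉ tsupport φ) : gradient φ x = 0 := by
  refine ext_inner_right ℝ fun v => ?_
  rw [inner_gradient_left, fderiv_apply_eq_zero hx, inner_zero_left]

theorem continuous_gradient (hφ : IsTestFunction Ω φ) : Continuous (gradient φ) :=
  (InnerProductSpace.toDual ℝ _).symm.continuous.comp (hφ.1.continuous_fderiv (by simp))

theorem hasCompactSupport_gradient (hφ : IsTestFunction Ω φ) : HasCompactSupport (gradient φ) :=
  hφ.2.1.mono' fun _ hx => by_contra fun h => hx (gradient_eq_zero h)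

theorem mul (hφ : IsTestFunction Ω φ) (hψ : ContDiff ℝ ∞ ψ) :
    IsTestFunction Ω (fun x => ψ x * φ x) :=
  ⟨hψ.mul hφ.1, hφ.2.1.mul_left, (tsupport_mul_subset_right).trans hφ.2.2⟩

theorem const_mul (hφ : IsTestFunction Ω φ) (c : ℝ) : IsTestFunction Ω (fun x => c * φ x) :=
  hφ.mul contDiff_const

theorem add (hφ : IsTestFunction Ω φ) (hψ : IsTestFunction Ω ψ) :
    IsTestFunction Ω (fun x => φ x + ψ x) :=
  ⟨hφ.1.add hψ.1, hφ.2.1.add hψ.2.1,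
    (tsupport_add φ ψ).trans (union_subset hφ.2.2 hψ.2.2)⟩

theorem gradient_add (hφ : IsTestFunction Ω φ) (hψ : IsTestFunction Ω ψ)
    (x : EuclideanSpace ℝ (Fin d)) :
    gradient (fun y => φ y + ψ y) x = gradient φ x + gradient ψ x := by
  refine ext_inner_right ℝ fun v => ?_
  rw [inner_add_left, inner_gradient_left, inner_gradient_left, inner_gradient_left,
    fderiv_fun_add (hφ.differentiable x) (hψ.differentiable x)]
  rfl

theorem gradient_const_mul (hφ : IsTestFunction Ω φ) (c : ℝ) (x : EuclideanSpace ℝ (Fin d)) :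
    gradient (fun y => c * φ y) x = c • gradient φ x := by
  refine ext_inner_right ℝ fun v => ?_
  rw [real_inner_smul_left, inner_gradient_left, inner_gradient_left,
    fderiv_const_mul (hφ.differentiable x)]
  rfl

theorem memLp (hφ : IsTestFunction Ω φ) (q : ℝ≥0∞) (μ : Measure (EuclideanSpace ℝ (Fin d)))
    [IsFiniteMeasureOnCompacts μ] : MemLp φ q μ :=
  hφ.continuous.memLp_of_hasCompactSupport hφ.2.1

theorem memLp_gradient (hφ : IsTestFunction Ω φ) (q : ℝ≥0∞)
    (μ : Measure (EuclideanSpace ℝ (Fin d))) [IsFiniteMeasureOnCompacts μ] :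
    MemLp (gradient φ) q μ :=
  hφ.continuous_gradient.memLp_of_hasCompactSupport hφ.hasCompactSupport_gradient

/-- A test function has its classical gradient as weak gradient. -/
theorem hasWeakGradient (hφ : IsTestFunction Ω φ) : HasWeakGradient Ω φ (gradient φ) := by
  refine ⟨hφ.continuous.locallyIntegrable.locallyIntegrableOn _,
    hφ.continuous_gradient.locallyIntegrable.locallyIntegrableOn _, fun ψ hψ v => ?_⟩
  rw [setIntegral_eq_integral_of_forall_compl_eq_zero fun x hx => by rw [hφ.eq_zero hx, zero_mul],
    setIntegral_eq_integral_of_forall_compl_eq_zero fun x hx => by rw [hψ.eq_zero hx, zero_mul],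
    integral_mul_fderiv_eq_neg_fderiv_mul_of_integrable]
  · simp only [inner_gradient_left, mul_comm]
  · exact ((hφ.continuous_fderiv_apply v).mul hψ.continuous).integrable_of_hasCompactSupport
      hψ.2.1.mul_left
  · exact (hφ.continuous.mul (hψ.continuous_fderiv_apply v)).integrable_of_hasCompactSupport
      hφ.2.1.mul_right
  · exact (hφ.continuous.mul hψ.continuous).integrable_of_hasCompactSupport hφ.2.1.mul_right
  · exact fun x _ => hφ.differentiable x
  · exact fun x _ => hψ.differentiable x

end IsTestFunction

namespace HasWeakGradient

variable {u w : EuclideanSpace ℝ (Fin d) → ℝ}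
  {G H : EuclideanSpace ℝ (Fin d) → EuclideanSpace ℝ (Fin d)}
  {φ : EuclideanSpace ℝ (Fin d) → ℝ}

theorem integrable_mul_fderiv (h : HasWeakGradient Ω u G) (hφ : IsTestFunction Ω φ)
    (v : EuclideanSpace ℝ (Fin d)) : Integrable fun x => u x * fderiv ℝ φ x v := by
  simpa [mul_comm] using h.1.integrable_smul_of_tsupport_subset (hφ.continuous_fderiv_apply v)
    (hφ.hasCompactSupport_fderiv_apply v) (hφ.tsupport_fderiv_apply_subset v)

theorem integrable_mul_inner (h : HasWeakGradient Ω u G) (hφ : IsTestFunction Ω φ)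
    (v : EuclideanSpace ℝ (Fin d)) : Integrable fun x => φ x * inner ℝ (G x) v := by
  simpa only [real_inner_smul_left] using Integrable.inner_const (𝕜 := ℝ)
    (h.2.1.integrable_smul_of_tsupport_subset hφ.continuous hφ.2.1 hφ.2.2) v

/-- The weak gradient is unique up to null sets. -/
theorem ae_eq (hΩ : IsOpen Ω) (hG : HasWeakGradient Ω u G) (hH : HasWeakGradient Ω u H) :
    G =ᵐ[volume.restrict Ω] H := by
  -- The fundamental lemma of the calculus of variations applied to the vector field `G - H`; the
  -- vector integrals are compared by pairing with each direction `v`.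
  have key := hΩ.ae_eq_zero_of_integral_contDiff_smul_eq_zero (hG.2.1.sub hH.2.1)
    fun φ h1 h2 h3 => ?_
  · rw [Filter.EventuallyEq, ae_restrict_iff' hΩ.measurableSet]
    filter_upwards [key] with x hx hxΩ
    exact sub_eq_zero.1 (hx hxΩ)
  · have hφ : IsTestFunction Ω φ := ⟨h1, h2, h3⟩
    have hi := hG.2.1.integrable_smul_of_tsupport_subset hφ.continuous hφ.2.1 hφ.2.2
    have hj := hH.2.1.integrable_smul_of_tsupport_subset hφ.continuous hφ.2.1 hφ.2.2
    simp only [Pi.sub_apply, smul_sub]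
    rw [integral_sub hi hj, sub_eq_zero]
    refine ext_inner_right ℝ fun v => ?_
    have e1 := hG.2.2 φ hφ v
    have e2 := hH.2.2 φ hφ v
    rw [e1, neg_inj,
      setIntegral_eq_integral_of_forall_compl_eq_zero fun x hx => by rw [hφ.eq_zero hx, zero_mul],
      setIntegral_eq_integral_of_forall_compl_eq_zero fun x hx => by
        rw [hφ.eq_zero hx, zero_mul]] at e2
    rw [real_inner_comm, ← integral_inner hi, real_inner_comm, ← integral_inner hj]
    simpa only [real_inner_smul_right, real_inner_comm] using e2

theorem congr (h : HasWeakGradient Ω u G) (hu : u =ᵐ[volume.restrict Ω] w)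
    (hG : G =ᵐ[volume.restrict Ω] H) : HasWeakGradient Ω w H := by
  refine ⟨h.1.congr hu, h.2.1.congr hG, fun φ hφ v => ?_⟩
  rw [integral_congr_ae (f := fun x => w x * fderiv ℝ φ x v) (g := fun x => u x * fderiv ℝ φ x v)
    (hu.mono fun x hx => by simp only [hx]),
    integral_congr_ae (f := fun x => φ x * inner ℝ (H x) v) (g := fun x => φ x * inner ℝ (G x) v)
    (hG.mono fun x hx => by simp only [hx])]
  exact h.2.2 φ hφ v

theorem add (hu : HasWeakGradient Ω u G) (hw : HasWeakGradient Ω w H) :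
    HasWeakGradient Ω (fun x => u x + w x) (fun x => G x + H x) := by
  refine ⟨hu.1.add hw.1, hu.2.1.add hw.2.1, fun φ hφ v => ?_⟩
  simp only [add_mul, inner_add_left, mul_add]
  rw [integral_add (hu.integrable_mul_fderiv hφ v).integrableOn
    (hw.integrable_mul_fderiv hφ v).integrableOn,
    integral_add (hu.integrable_mul_inner hφ v).integrableOn
    (hw.integrable_mul_inner hφ v).integrableOn, hu.2.2 φ hφ v, hw.2.2 φ hφ v, neg_add]

theorem const_smul (hu : HasWeakGradient Ω u G) (c : ℝ) :
    HasWeakGradient Ω (fun x => c * u x) (fun x => c • G x) := by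
  refine ⟨hu.1.smul c, hu.2.1.smul c, fun φ hφ v => ?_⟩
  simp only [real_inner_smul_left, mul_assoc, mul_left_comm _ c]
  rw [integral_const_mul, integral_const_mul, hu.2.2 φ hφ v, mul_neg]

theorem sub (hu : HasWeakGradient Ω u G) (hw : HasWeakGradient Ω w H) :
    HasWeakGradient Ω (fun x => u x - w x) (fun x => G x - H x) := by
  simpa [sub_eq_add_neg] using hu.add (hw.const_smul (-1))

theorem zero : HasWeakGradient Ω 0 0 :=
  ⟨locallyIntegrableOn_zero, locallyIntegrableOn_zero, fun φ _ v => by simp⟩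

theorem sum {ι : Type*} (s : Finset ι) {u : ι → EuclideanSpace ℝ (Fin d) → ℝ}
    {G : ι → EuclideanSpace ℝ (Fin d) → EuclideanSpace ℝ (Fin d)}
    (h : ∀ i ∈ s, HasWeakGradient Ω (u i) (G i)) :
    HasWeakGradient Ω (fun x => ∑ i ∈ s, u i x) (fun x => ∑ i ∈ s, G i x) := by
  classical
  induction s using Finset.induction_on with
  | empty => exact zero
  | insert a s ha ih =>
    simp only [Finset.sum_insert ha]
    exact (h a (Finset.mem_insert_self _ _)).add
      (ih fun i hi => h i (Finset.mem_insert_of_mem hi))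

/-- Leibniz rule for the product with a test function. -/
theorem test_mul (hu : HasWeakGradient Ω u G) {χ : EuclideanSpace ℝ (Fin d) → ℝ}
    (hχ : IsTestFunction Ω χ) :
    HasWeakGradient Ω (fun x => χ x * u x) (fun x => χ x • G x + u x • gradient χ x) := by
  have hug : Integrable fun x => u x • gradient χ x := by
    have h := (hu.1.integrableOn_compact_subset hχ.2.2 hχ.2.1.isCompact).smul_continuousOn
      hχ.continuous_gradient.continuousOn hχ.2.1.isCompact
    refine (integrableOn_iff_integrable_of_support_subset fun x hx => ?_).1 h
    exact by_contra fun h0 => hx (by simp [IsTestFunction.gradient_eq_zero h0])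
  refine ⟨?_, ?_, fun φ hφ v => ?_⟩
  · exact (hu.1.integrable_smul_of_tsupport_subset hχ.continuous hχ.2.1
      hχ.2.2).locallyIntegrable.locallyIntegrableOn _
  · exact ((hu.2.1.integrable_smul_of_tsupport_subset hχ.continuous hχ.2.1 hχ.2.2).add
      hug).locallyIntegrable.locallyIntegrableOn _
  · have hχφ := hφ.mul hχ.1
    have e := hu.2.2 _ hχφ v
    have hi : Integrable fun x => φ x * inner ℝ (u x • gradient χ x) v := by
      have := (hu.1.integrable_smul_of_tsupport_subset
        (hφ.continuous.mul (hχ.continuous_fderiv_apply v)) hφ.2.1.mul_right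
        ((tsupport_mul_subset_left).trans hφ.2.2))
      refine this.congr (Eventually.of_forall fun x => ?_)
      simp only [real_inner_smul_left, inner_gradient_left, smul_eq_mul, Pi.mul_apply]; ring
    have hfd : ∀ x, fderiv ℝ (fun y => χ y * φ y) x v =
        χ x * fderiv ℝ φ x v + φ x * fderiv ℝ χ x v := fun x => by
      rw [fderiv_fun_mul (hχ.differentiable x) (hφ.differentiable x)]; simp
    have hsplit : ∀ x, χ x * u x * fderiv ℝ φ x v =
        u x * fderiv ℝ (fun y => χ y * φ y) x v - φ x * inner ℝ (u x • gradient χ x) v := by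
      intro x
      rw [hfd, real_inner_smul_left, inner_gradient_left]; ring
    simp only [hsplit, inner_add_left, mul_add]
    rw [integral_sub (hu.integrable_mul_fderiv hχφ v).integrableOn hi.integrableOn, e,
      integral_add _ hi.integrableOn]
    · simp only [real_inner_smul_left, mul_assoc, mul_left_comm (φ _)]; ring
    · refine (hu.integrable_mul_inner hχφ v).integrableOn.congr (Eventually.of_forall fun x => ?_)
      simp only [real_inner_smul_left]; ring

/-- A compactly supported function with weak gradient in `L^q` is approximated by test functions
together with its gradient. -/
theorem exists_isTestFunction_approx (hΩ : IsOpen Ω) {q : ℝ≥0∞} (hq : 1 ≤ q) (hq' : q ≠ ⊤)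
    (h : HasWeakGradient Ω w G) {K : Set (EuclideanSpace ℝ (Fin d))} (hK : IsCompact K)
    (hKΩ : K ⊆ Ω) (hw : ∀ x ∉ K, w x = 0) (hG : ∀ x ∉ K, G x = 0) (hwq : MemLp w q)
    (hGq : MemLp G q) {ε : ℝ≥0∞} (hε : ε ≠ 0) :
    ∃ ψ, IsTestFunction Ω ψ ∧ eLpNorm (ψ - w) q volume ≤ ε ∧
      eLpNorm (gradient ψ - G) q volume ≤ ε := by
  obtain ⟨χ, hχ, hχs, hχΩ, hχ1, -⟩ := hK.exists_contDiff_cutoff hΩ hKΩ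
  obtain ⟨δ, hδ, hδΩ⟩ := hK.exists_cthickening_subset_open hΩ hKΩ
  obtain ⟨δ₁, hδ₁, h1⟩ := hwq.exists_eLpNorm_normed_convolution_sub_le hq hq' hε
  obtain ⟨δ₂, hδ₂, h2⟩ := hGq.exists_eLpNorm_normed_convolution_sub_le hq hq' hε
  -- Below `δ` the mollified function stays supported inside `Ω`; below `δ₁` and `δ₂` the function
  -- and its gradient are `ε`-close.
  obtain ⟨r, hr, hrδ⟩ : ∃ r > 0, r < min δ (min δ₁ δ₂) :=
    exists_between (lt_min hδ (lt_min hδ₁ hδ₂))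
  rw [lt_min_iff, lt_min_iff] at hrδ
  let ρ : ContDiffBump (0 : EuclideanSpace ℝ (Fin d)) := ⟨r / 2, r, by positivity, by linarith⟩
  set η : EuclideanSpace ℝ (Fin d) → ℝ := ρ.normed volume with hη
  have hηs : HasCompactSupport η := ρ.hasCompactSupport_normed
  have hηc : ContDiff ℝ ∞ η := ρ.contDiff_normed
  have hwl : LocallyIntegrable w := hwq.locallyIntegrable hq
  have hGl : LocallyIntegrable G := hGq.locallyIntegrable hq
  set ψ := η ⋆[lsmul ℝ ℝ, volume] w with hψ
  have hsub : Function.support ψ ⊆ cthickening δ K := by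
    refine (support_convolution_subset _).trans ?_
    rw [hη, ρ.support_normed_eq]
    rintro _ ⟨a, ha, b, hb, rfl⟩
    refine mem_cthickening_of_dist_le _ b _ _ (by_contra fun hbK => hb (hw b hbK)) ?_
    have : dist a 0 < r := ha
    simp only [dist_add_self_left, dist_zero_right] at this ⊢
    exact (this.trans hrδ.1).le
  have hψt : IsTestFunction Ω ψ :=
    ⟨hηs.contDiff_convolution_left _ hηc hwl,
      HasCompactSupport.of_support_subset_isCompact hK.cthickening hsub,
      (closure_minimal hsub isClosed_cthickening).trans hδΩ⟩
  have hgrad : gradient ψ = η ⋆[lsmul ℝ ℝ, volume] G := by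
    ext1 x
    refine ext_inner_right ℝ fun v => ?_
    have hex : Integrable fun y => η (x - y) • G y :=
      (hηs.convolutionExists_left (lsmul ℝ ℝ) hηc.continuous hGl x).integrable_swap
    -- The kernel `η (x - ·)` may have support leaving `Ω`, so it is cut off by `χ`. Nothing is
    -- lost: `χ = 1` near `K`, and `w` and `G` vanish off `K`.
    have hθ : IsTestFunction Ω fun y => η (x - y) * χ y := by
      have hc : ContDiff ℝ ∞ fun y => η (x - y) := hηc.comp (contDiff_const.sub contDiff_id)
      exact IsTestFunction.mul ⟨hχ, hχs, hχΩ⟩ hc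
    have e := h.2.2 _ hθ v
    rw [setIntegral_eq_integral_of_forall_compl_eq_zero fun y hy => by
        rw [hw y (fun hyK => hy (hKΩ hyK)), zero_mul],
      setIntegral_eq_integral_of_forall_compl_eq_zero fun y hy => by
        rw [hG y (fun hyK => hy (hKΩ hyK)), inner_zero_left, mul_zero]] at e
    have hfd : ∀ y, w y * fderiv ℝ (fun y => η (x - y) * χ y) y v =
        - (fderiv ℝ η (x - y) v * w y) := by
      intro y
      by_cases hy : y ∈ K
      · have e1 : (fun y => η (x - y) * χ y) =ᶠ[𝓝 y] fun y => η (x - y) := by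
          filter_upwards [hχ1 y hy] with z hz
          simp [hz]
        rw [e1.fderiv_eq, HasFDerivAt.fderiv (f := fun y => η (x - y)) (((hηc.differentiable (by simp))
          (x - y)).hasFDerivAt.comp y ((hasFDerivAt_id y).const_sub x))]
        simp [mul_comm]
      · rw [hw y hy]; simp
    have hin : ∀ y, η (x - y) * χ y * inner ℝ (G y) v = inner ℝ v (η (x - y) • G y) := by
      intro y
      by_cases hy : y ∈ K
      · have := (hχ1 y hy).self_of_nhds
        rw [this, real_inner_smul_right, real_inner_comm]; simp
      · rw [hG y hy]; simp
    simp only [hfd, hin] at e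
    rw [integral_neg, neg_inj, integral_inner hex] at e
    rw [inner_gradient_left, hηs.fderiv_convolution_lsmul_apply (hηc.of_le (by simp)) hwl,
      convolution_lsmul_swap, real_inner_comm, ← e]
  refine ⟨ψ, hψt, h1 ρ hrδ.2.1, ?_⟩
  rw [hgrad]
  exact h2 ρ hrδ.2.2

end HasWeakGradient

end WeakGradient

/-! ### Chain rule, absolute value and positive part. -/

section ChainRule

variable {d : ℕ} {Ω : Set (EuclideanSpace ℝ (Fin d))}

theorem MeasureTheory.LocallyIntegrableOn.mono_of_norm_le {F F' : Type*} [NormedAddCommGroup F]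
    [NormedAddCommGroup F'] {f : EuclideanSpace ℝ (Fin d) → F}
    {g : EuclideanSpace ℝ (Fin d) → F'}
    (hf : LocallyIntegrableOn f Ω) (hg : AEStronglyMeasurable g (volume.restrict Ω))
    (h : ∀ x, ‖g x‖ ≤ ‖f x‖) : LocallyIntegrableOn g Ω := by
  intro x hx
  obtain ⟨s, hs, hfs⟩ := hf x hx
  refine ⟨s ∩ Ω, inter_mem hs self_mem_nhdsWithin, ?_⟩
  exact Integrable.mono (hfs.mono_set inter_subset_left) (hg.mono_set inter_subset_right)
    (Eventually.of_forall h)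

/-- Products of an `L^1`-convergent sequence with a bounded, a.e. convergent one. -/
theorem tendsto_integral_mul_of_tendsto_eLpNorm {α : Type*} [MeasurableSpace α] {μ : Measure α}
    {c : ℕ → α → ℝ} {c₀ : α → ℝ} {f : ℕ → α → ℝ} {f₀ : α → ℝ} {C : ℝ}
    (hc : ∀ n, AEStronglyMeasurable (c n) μ) (hcb : ∀ n x, |c n x| ≤ C)
    (hlim : ∀ᵐ x ∂μ, Tendsto (fun n => c n x) atTop (𝓝 (c₀ x)))
    (hf : ∀ n, Integrable (f n) μ) (hf₀ : Integrable f₀ μ)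
    (hL : Tendsto (fun n => eLpNorm (f n - f₀) 1 μ) atTop (𝓝 0)) :
    Tendsto (fun n => ∫ x, c n x * f n x ∂μ) atTop (𝓝 (∫ x, c₀ x * f₀ x ∂μ)) := by
  have hi : ∀ n {g : α → ℝ}, Integrable g μ → Integrable (fun x => c n x * g x) μ :=
    fun n g hg => hg.bdd_mul (hc n) (Eventually.of_forall (hcb n))
  -- Split `c n * f n = c n * f₀ + c n * (f n - f₀)`: dominated convergence handles the first term,
  -- and the second is at most `C` times the `L^1` distance.
  have h1 : Tendsto (fun n => ∫ x, c n x * f₀ x ∂μ) atTop (𝓝 (∫ x, c₀ x * f₀ x ∂μ)) := by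
    refine tendsto_integral_of_dominated_convergence (fun x => C * |f₀ x|)
      (fun n => (hi n hf₀).aestronglyMeasurable) (hf₀.abs.const_mul C) (fun n => ?_) ?_
    · refine Eventually.of_forall fun x => ?_
      rw [norm_mul]
      exact mul_le_mul_of_nonneg_right (hcb n x) (norm_nonneg _)
    · filter_upwards [hlim] with x hx using hx.mul_const _
  have h2 : Tendsto (fun n => ∫ x, c n x * (f n x - f₀ x) ∂μ) atTop (𝓝 0) := by
    have hnorm : ∀ n, ∫ x, ‖f n x - f₀ x‖ ∂μ = (eLpNorm (f n - f₀) 1 μ).toReal := fun n => by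
      rw [eLpNorm_one_eq_lintegral_enorm,
        ← integral_norm_eq_lintegral_enorm ((hf n).sub hf₀).aestronglyMeasurable]
      rfl
    have h3 : Tendsto (fun n => C * ∫ x, ‖f n x - f₀ x‖ ∂μ) atTop (𝓝 0) := by
      simp only [hnorm]
      simpa using ((ENNReal.tendsto_toReal ENNReal.zero_ne_top).comp hL).const_mul C
    refine squeeze_zero_norm (fun n => ?_) h3
    rw [← integral_const_mul]
    refine norm_integral_le_of_norm_le (((hf n).sub hf₀).norm.const_mul C)
      (Eventually.of_forall fun x => ?_)
    rw [norm_mul]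
    exact mul_le_mul_of_nonneg_right (hcb n x) (norm_nonneg _)
  have h4 := h1.add h2
  rw [add_zero] at h4
  refine h4.congr fun n => ?_
  rw [← integral_add (hi n hf₀) (hi n (g := fun x => f n x - f₀ x) ((hf n).sub hf₀))]
  exact integral_congr_ae (Eventually.of_forall fun x => by simp only; ring)

namespace HasWeakGradient

variable {u : EuclideanSpace ℝ (Fin d) → ℝ}
  {G : EuclideanSpace ℝ (Fin d) → EuclideanSpace ℝ (Fin d)}

theorem aestronglyMeasurable (h : HasWeakGradient Ω u G) :
    AEStronglyMeasurable u (volume.restrict Ω) := h.1.aestronglyMeasurable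

theorem aestronglyMeasurable_gradient (h : HasWeakGradient Ω u G) :
    AEStronglyMeasurable G (volume.restrict Ω) := h.2.1.aestronglyMeasurable

/-- Near the support of a test function, a function with weak gradient is an `L^1` limit of test
functions whose gradients converge as well. -/
theorem exists_seq_isTestFunction (hΩ : IsOpen Ω) (h : HasWeakGradient Ω u G)
    {K : Set (EuclideanSpace ℝ (Fin d))} (hK : IsCompact K) (hKΩ : K ⊆ Ω) :
    ∃ (ψ : ℕ → EuclideanSpace ℝ (Fin d) → ℝ) (w : EuclideanSpace ℝ (Fin d) → ℝ)
      (H : EuclideanSpace ℝ (Fin d) → EuclideanSpace ℝ (Fin d)),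
      (∀ n, IsTestFunction Ω (ψ n)) ∧ Integrable w ∧ Integrable H ∧
      (∀ x ∈ K, w x = u x ∧ H x = G x) ∧
      Tendsto (fun n => eLpNorm (ψ n - w) 1 volume) atTop (𝓝 0) ∧
      Tendsto (fun n => eLpNorm (gradient (ψ n) - H) 1 volume) atTop (𝓝 0) ∧
      ∀ᵐ x, Tendsto (fun n => ψ n x) atTop (𝓝 (w x)) := by
  obtain ⟨χ, hχ, hχs, hχΩ, hχ1, -⟩ := hK.exists_contDiff_cutoff hΩ hKΩ
  have hχt : IsTestFunction Ω χ := ⟨hχ, hχs, hχΩ⟩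
  have hw := h.test_mul hχt
  set w := fun x => χ x * u x with hwdef
  set H := fun x => χ x • G x + u x • gradient χ x with hHdef
  have hw0 : ∀ x ∉ tsupport χ, w x = 0 := fun x hx => by
    simp [hwdef, image_eq_zero_of_notMem_tsupport hx]
  have hH0 : ∀ x ∉ tsupport χ, H x = 0 := fun x hx => by
    simp [hHdef, image_eq_zero_of_notMem_tsupport hx, IsTestFunction.gradient_eq_zero hx]
  have hwi : Integrable w :=
    (integrableOn_iff_integrable_of_support_subset fun x hx => by_contra fun h0 => hx (hw0 x h0)).1
      (hw.1.integrableOn_compact_subset hχΩ hχs.isCompact)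
  have hHi : Integrable H :=
    (integrableOn_iff_integrable_of_support_subset fun x hx => by_contra fun h0 => hx (hH0 x h0)).1
      (hw.2.1.integrableOn_compact_subset hχΩ hχs.isCompact)
  -- For `n = 0` the bound is `⊤`, so the sequence can start there.
  have hex : ∀ n : ℕ, ∃ ψ, IsTestFunction Ω ψ ∧ eLpNorm (ψ - w) 1 volume ≤ (n : ℝ≥0∞)⁻¹ ∧
      eLpNorm (gradient ψ - H) 1 volume ≤ (n : ℝ≥0∞)⁻¹ := fun n =>
    hw.exists_isTestFunction_approx hΩ le_rfl ENNReal.one_ne_top hχs.isCompact hχΩ hw0 hH0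
      (memLp_one_iff_integrable.2 hwi) (memLp_one_iff_integrable.2 hHi) (by simp)
  choose ψ hψ hψw hψH using hex
  have lim1 : Tendsto (fun n => eLpNorm (ψ n - w) 1 volume) atTop (𝓝 0) :=
    tendsto_of_tendsto_of_tendsto_of_le_of_le tendsto_const_nhds
      ENNReal.tendsto_inv_nat_nhds_zero (fun _ => zero_le) hψw
  have lim2 : Tendsto (fun n => eLpNorm (gradient (ψ n) - H) 1 volume) atTop (𝓝 0) :=
    tendsto_of_tendsto_of_tendsto_of_le_of_le tendsto_const_nhds
      ENNReal.tendsto_inv_nat_nhds_zero (fun _ => zero_le) hψH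
  -- `L^1` convergence gives convergence in measure, hence a subsequence converging a.e.
  obtain ⟨ns, hns, hae⟩ := (tendstoInMeasure_of_tendsto_eLpNorm one_ne_zero
    (fun n => (hψ n).continuous.aestronglyMeasurable) hwi.aestronglyMeasurable
    lim1).exists_seq_tendsto_ae
  refine ⟨fun n => ψ (ns n), w, H, fun n => hψ _, hwi, hHi, fun x hx => ?_,
    lim1.comp hns.tendsto_atTop, lim2.comp hns.tendsto_atTop, hae⟩
  have e1 : χ x = 1 := (hχ1 x hx).self_of_nhds
  have e2 : gradient χ x = 0 := by
    rw [(hχ1 x hx).gradient_eq]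
    refine ext_inner_right ℝ fun v => ?_
    rw [inner_gradient_left, inner_zero_left]
    rw [fderiv_one]; rfl
  simp [hwdef, hHdef, e1, e2]

theorem locallyIntegrableOn_comp (h : HasWeakGradient Ω u G) {F : ℝ → ℝ} {C : ℝ}
    (hm : AEStronglyMeasurable (fun x => F (u x)) (volume.restrict Ω))
    (hF : ∀ t, |F t| ≤ C + |t|) : LocallyIntegrableOn (fun x => F (u x)) Ω := by
  refine LocallyIntegrableOn.mono_of_norm_le (f := fun x => C + |u x|)
    ((locallyIntegrableOn_const C).add h.1.norm) hm fun x => ?_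
  exact (hF _).trans (le_abs_self _)

/-- Chain rule for `C^1` functions with bounded derivative. -/
theorem comp_of_hasDerivAt (hΩ : IsOpen Ω) (h : HasWeakGradient Ω u G) {F F' : ℝ → ℝ}
    (hF : ∀ t, HasDerivAt F (F' t) t) (hF' : Continuous F') (hb : ∀ t, |F' t| ≤ 1) :
    HasWeakGradient Ω (fun x => F (u x)) (fun x => F' (u x) • G x) := by
  have hFc : Continuous F := continuous_iff_continuousAt.2 fun t => (hF t).continuousAt
  have hlip : ∀ s t, |F s - F t| ≤ |s - t| := fun s t => by
    have := Convex.norm_image_sub_le_of_norm_hasDerivWithin_le (s := univ)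
      (fun x _ => (hF x).hasDerivWithinAt) (fun x _ => hb x) convex_univ (mem_univ t) (mem_univ s)
    simpa using this
  refine ⟨h.locallyIntegrableOn_comp (C := |F 0|)
      (hFc.comp_aestronglyMeasurable h.aestronglyMeasurable) fun t => ?_,
    LocallyIntegrableOn.mono_of_norm_le h.2.1
      ((hF'.comp_aestronglyMeasurable h.aestronglyMeasurable).smul
        h.aestronglyMeasurable_gradient) fun x => ?_, fun φ hφ v => ?_⟩
  · have := hlip t 0
    have h3 := abs_sub_abs_le_abs_sub (F t) (F 0)
    rw [sub_zero] at this
    linarith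
  · rw [norm_smul]
    exact mul_le_of_le_one_left (norm_nonneg _) (hb _)
  · obtain ⟨ψ, w, H, hψ, hw, hH, heq, hlim1, hlim2, hae⟩ :=
      h.exists_seq_isTestFunction hΩ hφ.2.1.isCompact hφ.2.2
    -- Classical integration by parts for the smooth approximants; the claim is its limit, as `w =
    -- u` and `H = G` on the support of `φ`.
    have hibp : ∀ n, ∫ x, F (ψ n x) * fderiv ℝ φ x v =
        -∫ x, φ x * F' (ψ n x) * inner ℝ (gradient (ψ n) x) v := fun n => by
      have hd : ∀ x, HasFDerivAt (fun y => F (ψ n y)) (F' (ψ n x) • fderiv ℝ (ψ n) x) x :=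
        fun x => (hF _).comp_hasFDerivAt x ((hψ n).differentiable x).hasFDerivAt
      have hdv : ∀ x, fderiv ℝ (fun y => F (ψ n y)) x v = F' (ψ n x) * fderiv ℝ (ψ n) x v :=
        fun x => by rw [(hd x).fderiv]; rfl
      rw [integral_mul_fderiv_eq_neg_fderiv_mul_of_integrable]
      · simp only [hdv, inner_gradient_left]
        congr 2; ext x; ring
      · simp only [hdv]
        exact (((hF'.comp (hψ n).continuous).mul ((hψ n).continuous_fderiv_apply v)).mul
          hφ.continuous).integrable_of_hasCompactSupport hφ.2.1.mul_left
      · exact ((hFc.comp (hψ n).continuous).mul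
          (hφ.continuous_fderiv_apply v)).integrable_of_hasCompactSupport
          (hφ.hasCompactSupport_fderiv_apply v).mul_left
      · exact ((hFc.comp (hψ n).continuous).mul
          hφ.continuous).integrable_of_hasCompactSupport hφ.2.1.mul_left
      · exact fun x _ => (hd x).differentiableAt
      · exact fun x _ => hφ.differentiable x
    obtain ⟨C, hC⟩ := hφ.continuous.bounded_above_of_compact_support hφ.2.1
    obtain ⟨D, hD⟩ := (hφ.continuous_fderiv_apply v).bounded_above_of_compact_support
      (hφ.hasCompactSupport_fderiv_apply v)
    have hC0 : 0 ≤ C := (norm_nonneg _).trans (hC 0)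
    -- The gradients converge in `L^1`, while the coefficients `φ * F' (ψ n)` are bounded and
    -- converge a.e. because `F'` is continuous.
    have limR : Tendsto (fun n => ∫ x, φ x * F' (ψ n x) * inner ℝ (gradient (ψ n) x) v) atTop
        (𝓝 (∫ x, φ x * F' (w x) * inner ℝ (H x) v)) := by
      refine tendsto_integral_mul_of_tendsto_eLpNorm (C := C)
        (fun n => (hφ.continuous.mul (hF'.comp (hψ n).continuous)).aestronglyMeasurable)
        (fun n x => ?_) ?_ (fun n => ?_) (hH.inner_const v) ?_
      · rw [abs_mul]
        calc _ ≤ C * 1 := mul_le_mul (hC x) (hb _) (abs_nonneg _) hC0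
          _ = C := mul_one C
      · filter_upwards [hae] with x hx
        exact ((hF'.tendsto _).comp hx).const_mul _
      · exact Integrable.inner_const (𝕜 := ℝ)
          (memLp_one_iff_integrable.1 ((hψ n).memLp_gradient 1 volume)) v
      · have hup : Tendsto (fun n => ENNReal.ofReal ‖v‖ *
            eLpNorm (gradient (ψ n) - H) 1 volume) atTop (𝓝 0) := by
          simpa only [mul_zero] using
            ENNReal.Tendsto.const_mul hlim2 (Or.inr (ENNReal.ofReal_ne_top (r := ‖v‖)))
        refine tendsto_of_tendsto_of_tendsto_of_le_of_le tendsto_const_nhds hup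
          (fun _ => zero_le) fun n => ?_
        refine eLpNorm_le_mul_eLpNorm_of_ae_le_mul (Eventually.of_forall fun x => ?_) 1
        rw [Pi.sub_apply, ← inner_sub_left, mul_comm]
        exact norm_inner_le_norm _ _
    have limL : Tendsto (fun n => ∫ x, F (ψ n x) * fderiv ℝ φ x v) atTop
        (𝓝 (∫ x, F (w x) * fderiv ℝ φ x v)) := by
      have hsm : ∀ {f : EuclideanSpace ℝ (Fin d) → ℝ}, Integrable f →
          Integrable fun x => F (f x) * fderiv ℝ φ x v := fun {f} hf => by
        have hl : LocallyIntegrable fun x => F (f x) := by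
          rw [← locallyIntegrableOn_univ]
          refine LocallyIntegrableOn.mono_of_norm_le (f := fun x => |F 0| + |f x|)
            ((locallyIntegrableOn_const _).add (hf.norm.locallyIntegrable.locallyIntegrableOn _))
            (hFc.comp_aestronglyMeasurable hf.aestronglyMeasurable.restrict) fun x => ?_
          have := hlip (f x) 0
          have h3 := abs_sub_abs_le_abs_sub (F (f x)) (F 0)
          rw [sub_zero] at this
          rw [Real.norm_eq_abs]
          exact le_trans (by linarith) (le_abs_self _)
        simpa [mul_comm] using hl.integrable_smul_left_of_hasCompactSupport
          (hφ.continuous_fderiv_apply v) (hφ.hasCompactSupport_fderiv_apply v)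
      -- `F` is 1-Lipschitz, so it carries the `L^1` convergence of `ψ n` over to `F (ψ n)`.
      refine tendsto_integral_of_L1 _ (hsm hw).aestronglyMeasurable
        (Eventually.of_forall fun n => hsm (memLp_one_iff_integrable.1 ((hψ n).memLp 1 volume))) ?_
      have hup : Tendsto (fun n => ENNReal.ofReal D * eLpNorm (ψ n - w) 1 volume) atTop
          (𝓝 0) := by
        simpa using ENNReal.Tendsto.const_mul hlim1 (Or.inr ENNReal.ofReal_ne_top)
      refine tendsto_of_tendsto_of_tendsto_of_le_of_le tendsto_const_nhds hup
        (fun _ => zero_le) fun n => ?_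
      simp only [← eLpNorm_one_eq_lintegral_enorm]
      refine eLpNorm_le_mul_eLpNorm_of_ae_le_mul (Eventually.of_forall fun x => ?_) 1
      rw [← sub_mul, norm_mul, mul_comm]
      exact mul_le_mul (hD x) (hlip _ _) (norm_nonneg _) ((norm_nonneg _).trans (hD x))
    have hfin := tendsto_nhds_unique limL (limR.neg.congr fun n => (hibp n).symm)
    rw [setIntegral_eq_integral_of_forall_compl_eq_zero fun x hx => by
        rw [IsTestFunction.fderiv_apply_eq_zero (fun h => hx (hφ.2.2 h)), mul_zero],
      setIntegral_eq_integral_of_forall_compl_eq_zero fun x hx => by rw [hφ.eq_zero hx, zero_mul]]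
    convert hfin using 2
    · ext x
      by_cases hx : x ∈ tsupport φ
      · rw [(heq x hx).1]
      · rw [IsTestFunction.fderiv_apply_eq_zero hx, mul_zero, mul_zero]
    · congr 1
      ext x
      by_cases hx : x ∈ tsupport φ
      · rw [(heq x hx).1, (heq x hx).2, real_inner_smul_left, mul_assoc]
      · rw [image_eq_zero_of_notMem_tsupport hx]; simp

/-- Chain rule for pointwise limits of `C^1` functions with bounded derivative. -/
theorem comp_of_tendsto (hΩ : IsOpen Ω) (h : HasWeakGradient Ω u G) {F F' : ℕ → ℝ → ℝ}
    {F₀ f : ℝ → ℝ} {C : ℝ} (hF : ∀ n t, HasDerivAt (F n) (F' n t) t)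
    (hF' : ∀ n, Continuous (F' n)) (hb : ∀ n t, |F' n t| ≤ 1) (hC : ∀ n t, |F n t| ≤ C + |t|)
    (hlim : ∀ t, Tendsto (fun n => F n t) atTop (𝓝 (F₀ t)))
    (hlim' : ∀ t, Tendsto (fun n => F' n t) atTop (𝓝 (f t))) :
    HasWeakGradient Ω (fun x => F₀ (u x)) (fun x => f (u x) • G x) := by
  have hn : ∀ n, HasWeakGradient Ω (fun x => F n (u x)) (fun x => F' n (u x) • G x) :=
    fun n => h.comp_of_hasDerivAt hΩ (hF n) (hF' n) (hb n)
  have hC₀ : ∀ t, |F₀ t| ≤ C + |t| := fun t =>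
    le_of_tendsto (hlim t).abs (Eventually.of_forall fun n => hC n t)
  have hb₀ : ∀ t, |f t| ≤ 1 := fun t =>
    le_of_tendsto (hlim' t).abs (Eventually.of_forall fun n => hb n t)
  refine ⟨h.locallyIntegrableOn_comp (aestronglyMeasurable_of_tendsto_ae atTop
      (fun n => (hn n).aestronglyMeasurable) (Eventually.of_forall fun x => hlim (u x))) hC₀,
    LocallyIntegrableOn.mono_of_norm_le h.2.1 (aestronglyMeasurable_of_tendsto_ae atTop
      (fun n => (hn n).aestronglyMeasurable_gradient)
      (Eventually.of_forall fun x => (hlim' (u x)).smul_const (G x))) fun x => ?_,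
    fun φ hφ v => ?_⟩
  · rw [norm_smul]
    exact mul_le_of_le_one_left (norm_nonneg _) (hb₀ _)
  -- Both sides pass to the limit by dominated convergence with `u` fixed; hence `f` may be
  -- discontinuous, which allows kinks in `F₀`.
  · have limL : Tendsto (fun n => ∫ x in Ω, F n (u x) * fderiv ℝ φ x v) atTop
        (𝓝 (∫ x in Ω, F₀ (u x) * fderiv ℝ φ x v)) := by
      refine tendsto_integral_of_dominated_convergence
        (fun x => (C + |u x|) * |fderiv ℝ φ x v|)
        (fun n => ((hn n).integrable_mul_fderiv hφ v).aestronglyMeasurable.restrict) ?_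
        (fun n => Eventually.of_forall fun x => ?_)
        (Eventually.of_forall fun x => (hlim (u x)).mul_const _)
      · have := ((locallyIntegrableOn_const C).add h.1.norm).integrable_smul_of_tsupport_subset
          (hφ.continuous_fderiv_apply v).abs (ψ := fun x => |fderiv ℝ φ x v|)
          (hφ.hasCompactSupport_fderiv_apply v).norm ?_
        · simpa [mul_comm] using this.restrict (s := Ω)
        · refine (closure_mono fun x hx => ?_).trans (hφ.tsupport_fderiv_apply_subset v)
          exact fun h0 => hx (by simp only [h0, abs_zero])
      · rw [norm_mul]
        exact mul_le_mul_of_nonneg_right (hC _ _) (norm_nonneg _)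
    have limR : Tendsto (fun n => ∫ x in Ω, φ x * inner ℝ (F' n (u x) • G x) v) atTop
        (𝓝 (∫ x in Ω, φ x * inner ℝ (f (u x) • G x) v)) := by
      refine tendsto_integral_of_dominated_convergence
        (fun x => ‖φ x * inner ℝ (G x) v‖)
        (fun n => ((hn n).integrable_mul_inner hφ v).aestronglyMeasurable.restrict)
        (h.integrable_mul_inner hφ v).norm.integrableOn
        (fun n => Eventually.of_forall fun x => ?_)
        (Eventually.of_forall fun x =>
          (((hlim' (u x)).smul_const (G x)).inner tendsto_const_nhds).const_mul _)
      rw [real_inner_smul_left, norm_mul, norm_mul, norm_mul]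
      gcongr
      exact mul_le_of_le_one_left (norm_nonneg _) (hb _ _)
    exact tendsto_nhds_unique limL (limR.neg.congr fun n => ((hn n).2.2 φ hφ v).symm)

/-- The weak gradient of `|u|` is `sign u • ∇u`. -/
theorem abs (hΩ : IsOpen Ω) (h : HasWeakGradient Ω u G) :
    HasWeakGradient Ω (fun x => |u x|) (fun x => (u x / |u x|) • G x) := by
  have hpos : ∀ (n : ℕ) (t : ℝ), 0 < t ^ 2 + ((n : ℝ) + 1)⁻¹ ^ 2 := fun n t => by positivity
  have hle : ∀ (n : ℕ) (t : ℝ), |t| ≤ √(t ^ 2 + ((n : ℝ) + 1)⁻¹ ^ 2) := fun n t => by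
    rw [← Real.sqrt_sq_eq_abs]
    exact Real.sqrt_le_sqrt (by nlinarith [sq_nonneg ((n : ℝ) + 1)⁻¹])
  have hinv : Tendsto (fun n : ℕ => ((n : ℝ) + 1)⁻¹) atTop (𝓝 0) := by
    simpa using tendsto_one_div_add_atTop_nhds_zero_nat (𝕜 := ℝ)
  have hs : ∀ t : ℝ, Tendsto (fun n : ℕ => √(t ^ 2 + ((n : ℝ) + 1)⁻¹ ^ 2)) atTop (𝓝 |t|) := by
    intro t
    have := ((hinv.pow 2).const_add (t ^ 2)).sqrt
    simpa [Real.sqrt_sq_eq_abs] using this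
  -- At `t = 0` the convention `0 / 0 = 0` agrees with the vanishing derivative of the even
  -- approximants, so `t / |t|` is their limit everywhere.
  refine h.comp_of_tendsto hΩ (C := 1) (F := fun n t => √(t ^ 2 + ((n : ℝ) + 1)⁻¹ ^ 2))
    (F' := fun n t => t / √(t ^ 2 + ((n : ℝ) + 1)⁻¹ ^ 2)) (F₀ := fun t => |t|)
    (f := fun t => t / |t|) (fun n t => ?_) (fun n => ?_) (fun n t => ?_) (fun n t => ?_) hs
    fun t => ?_
  · convert ((hasDerivAt_pow 2 t).add_const (((n : ℝ) + 1)⁻¹ ^ 2)).sqrt (hpos n t).ne' using 1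
    rw [Nat.cast_ofNat, pow_one, mul_div_mul_left _ _ two_ne_zero]
  · exact continuous_id.div (by fun_prop) fun t => (Real.sqrt_pos.2 (hpos n t)).ne'
  · rw [abs_div, abs_of_nonneg (Real.sqrt_nonneg _)]
    exact div_le_one_of_le₀ (hle n t) (Real.sqrt_nonneg _)
  · rw [abs_of_nonneg (Real.sqrt_nonneg _), Real.sqrt_le_iff]
    have h1 : ((n : ℝ) + 1)⁻¹ ≤ 1 := inv_le_one_of_one_le₀ (by simp)
    have h2 : 0 ≤ ((n : ℝ) + 1)⁻¹ := by positivity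
    exact ⟨by positivity, by nlinarith [sq_abs t, abs_nonneg t]⟩
  · rcases eq_or_ne t 0 with rfl | ht
    · simp
    · exact tendsto_const_nhds.div (hs t) (abs_ne_zero.2 ht)

/-- The weak gradient vanishes almost everywhere on the zero set. -/
theorem ae_eq_zero_of_eq_zero (hΩ : IsOpen Ω) (h : HasWeakGradient Ω u G) :
    ∀ᵐ x ∂(volume.restrict Ω), u x = 0 → G x = 0 := by
  have hp : ∀ n : ℕ, (0 : ℝ) < (n : ℝ) + 1 := fun n => by positivity
  have hinv : Tendsto (fun n : ℕ => ((n : ℝ) + 1)⁻¹) atTop (𝓝 0) := by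
    simpa using tendsto_one_div_add_atTop_nhds_zero_nat (𝕜 := ℝ)
  have hab : ∀ t, |Real.arctan t| ≤ 2 := fun t => by
    rw [abs_le]
    constructor <;> linarith [Real.neg_pi_div_two_lt_arctan t, Real.arctan_lt_pi_div_two t,
      Real.pi_lt_four]
  -- The rescaled arctangents tend to `0` uniformly, yet their derivatives tend to the indicator of
  -- `{0}`. Thus `1_{u = 0} G` is a weak gradient of the zero function, and uniqueness kills it.
  have key : HasWeakGradient Ω (fun x => (fun _ => (0 : ℝ)) (u x))
      (fun x => (if u x = 0 then (1 : ℝ) else 0) • G x) := by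
    refine h.comp_of_tendsto hΩ (C := 2)
      (F := fun n t => ((n : ℝ) + 1)⁻¹ * Real.arctan (((n : ℝ) + 1) * t))
      (F' := fun n t => 1 / (1 + (((n : ℝ) + 1) * t) ^ 2))
      (F₀ := fun _ => 0) (f := fun t => if t = 0 then (1 : ℝ) else 0)
      (fun n t => ?_) (fun n => ?_) (fun n t => ?_) (fun n t => ?_) (fun t => ?_) fun t => ?_
    · have := (((hasDerivAt_id t).const_mul ((n : ℝ) + 1)).arctan).const_mul ((n : ℝ) + 1)⁻¹
      refine this.congr_deriv ?_
      rw [mul_one, mul_comm (1 / _), inv_mul_cancel_left₀ (hp n).ne', id]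
    · exact continuous_const.div (by fun_prop) fun t => by positivity
    · rw [abs_of_nonneg (by positivity)]
      exact div_le_one_of_le₀ (by nlinarith [sq_nonneg (((n : ℝ) + 1) * t)]) (by positivity)
    · rw [abs_mul, abs_of_pos (inv_pos.2 (hp n))]
      have h1 : ((n : ℝ) + 1)⁻¹ ≤ 1 := inv_le_one_of_one_le₀ (by simp)
      have := mul_le_mul h1 (hab (((n : ℝ) + 1) * t)) (abs_nonneg _) zero_le_one
      linarith [abs_nonneg t]
    · refine squeeze_zero_norm (a := fun n : ℕ => ((n : ℝ) + 1)⁻¹ * 2) (fun n => ?_) ?_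
      · rw [norm_mul, Real.norm_of_nonneg (inv_pos.2 (hp n)).le]
        exact mul_le_mul_of_nonneg_left (hab _) (inv_pos.2 (hp n)).le
      · simpa using hinv.mul_const 2
    · split_ifs with ht
      · simp [ht]
      · have h1 : Tendsto (fun n : ℕ => (n : ℝ) + 1) atTop atTop :=
          tendsto_atTop_add_const_right _ _ tendsto_natCast_atTop_atTop
        have h2 : Tendsto (fun n : ℕ => 1 + (((n : ℝ) + 1) * t) ^ 2) atTop atTop := by
          refine tendsto_atTop_add_const_left _ _ ?_
          simp only [mul_pow]
          exact ((tendsto_pow_atTop two_ne_zero).comp h1).atTop_mul_const (by positivity)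
        simp only [one_div]
        exact h2.inv_tendsto_atTop
  filter_upwards [key.ae_eq hΩ zero] with x hx hux
  simpa [hux] using hx

/-- The weak gradient of the positive part. -/
theorem posPart (hΩ : IsOpen Ω) (h : HasWeakGradient Ω u G) :
    HasWeakGradient Ω (fun x => max (u x) 0) (fun x => if 0 < u x then G x else 0) := by
  -- `u⁺ = (u + |u|) / 2`. On `{u = 0}` this formula produces `G / 2`, which is null by the
  -- preceding lemma.
  refine ((h.add (h.abs hΩ)).const_smul 2⁻¹).congr (Eventually.of_forall fun x => ?_) ?_
  · rcases le_total 0 (u x) with hx | hx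
    · simp only [abs_of_nonneg hx, max_eq_left hx]; ring
    · simp only [abs_of_nonpos hx, max_eq_right hx]; ring
  · filter_upwards [h.ae_eq_zero_of_eq_zero hΩ] with x hx
    rcases lt_trichotomy 0 (u x) with h0 | h0 | h0
    · rw [abs_of_pos h0, div_self h0.ne', if_pos h0, one_smul, ← two_smul ℝ, smul_smul]
      norm_num
    · simp [hx h0.symm]
    · rw [abs_of_neg h0, div_neg, div_self h0.ne, if_neg h0.not_gt]
      simp

end HasWeakGradient

end ChainRule

/-! ### The spaces `W^{1,p}` and `W_0^{1,p}`. -/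

section Sobolev

variable {d : ℕ} {Ω : Set (EuclideanSpace ℝ (Fin d))} {p : ℝ}
  {u w : EuclideanSpace ℝ (Fin d) → ℝ}
  {G : EuclideanSpace ℝ (Fin d) → EuclideanSpace ℝ (Fin d)}

/-- `weakGradient` is an arbitrary choice; uniqueness makes it computable from any weak gradient
exhibited by hand. -/
theorem HasWeakGradient.weakGradient_ae_eq (hΩ : IsOpen Ω) (h : HasWeakGradient Ω u G) :
    weakGradient Ω u =ᵐ[volume.restrict Ω] G := by
  have hex : ∃ G, HasWeakGradient Ω u G := ⟨G, h⟩
  rw [weakGradient, dif_pos hex]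
  exact hex.choose_spec.ae_eq hΩ h

theorem one_le_ofReal_of_one_lt (hp : 1 < p) : 1 ≤ ENNReal.ofReal p := by
  rw [← ENNReal.ofReal_one]
  exact ENNReal.ofReal_le_ofReal hp.le

namespace MemW1p

theorem hasWeakGradient (h : MemW1p Ω p u) : HasWeakGradient Ω u (weakGradient Ω u) := by
  have hex : ∃ G, HasWeakGradient Ω u G := h.2.imp fun _ h => h.1
  rw [weakGradient, dif_pos hex]
  exact hex.choose_spec

theorem memLp_weakGradient (hΩ : IsOpen Ω) (h : MemW1p Ω p u) :
    MemLp (weakGradient Ω u) (ENNReal.ofReal p) (volume.restrict Ω) := by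
  obtain ⟨G, hG, hGp⟩ := h.2
  exact hGp.ae_eq (hG.weakGradient_ae_eq hΩ).symm

theorem integrable_norm_weakGradient_rpow (hΩ : IsOpen Ω) (hp : 1 < p) (h : MemW1p Ω p u) :
    Integrable (fun x => ‖weakGradient Ω u x‖ ^ p) (volume.restrict Ω) := by
  have := (h.memLp_weakGradient hΩ).integrable_norm_rpow
    (zero_lt_one.trans_le (one_le_ofReal_of_one_lt hp)).ne' ENNReal.ofReal_ne_top
  rwa [ENNReal.toReal_ofReal (zero_lt_one.trans hp).le] at this

theorem add (hu : MemW1p Ω p u) (hw : MemW1p Ω p w) : MemW1p Ω p (fun x => u x + w x) := by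
  obtain ⟨G, hG, hGp⟩ := hu.2
  obtain ⟨H, hH, hHp⟩ := hw.2
  exact ⟨hu.1.add hw.1, _, hG.add hH, hGp.add hHp⟩

theorem const_mul (hu : MemW1p Ω p u) (c : ℝ) : MemW1p Ω p (fun x => c * u x) := by
  obtain ⟨G, hG, hGp⟩ := hu.2
  exact ⟨hu.1.const_mul c, _, hG.const_smul c, hGp.const_smul c⟩

theorem sub (hu : MemW1p Ω p u) (hw : MemW1p Ω p w) : MemW1p Ω p (fun x => u x - w x) := by
  simpa [sub_eq_add_neg] using hu.add (hw.const_mul (-1))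

theorem sum {ι : Type*} (s : Finset ι) {u : ι → EuclideanSpace ℝ (Fin d) → ℝ}
    (h : ∀ i ∈ s, MemW1p Ω p (u i)) : MemW1p Ω p (fun x => ∑ i ∈ s, u i x) := by
  choose! G hG hGp using fun i hi => (h i hi).2
  exact ⟨memLp_finsetSum s fun i hi => (h i hi).1, _, HasWeakGradient.sum s hG,
    memLp_finsetSum s hGp⟩

theorem posPart (hΩ : IsOpen Ω) (hu : MemW1p Ω p u) : MemW1p Ω p (fun x => max (u x) 0) := by
  obtain ⟨G, hG, hGp⟩ := hu.2
  have h := hG.posPart hΩ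
  refine ⟨hu.1.of_le h.aestronglyMeasurable (Eventually.of_forall fun x => ?_), _, h,
    hGp.of_le h.aestronglyMeasurable_gradient (Eventually.of_forall fun x => ?_)⟩
  · rw [Real.norm_of_nonneg (le_max_right _ _)]
    exact max_le (le_abs_self _) (abs_nonneg _)
  · split_ifs <;> simp

end MemW1p

theorem IsTestFunction.memW1p {φ : EuclideanSpace ℝ (Fin d) → ℝ} (hφ : IsTestFunction Ω φ) :
    MemW1p Ω p φ :=
  ⟨hφ.memLp _ _, _, hφ.hasWeakGradient, hφ.memLp_gradient _ _⟩

/-- Compactly supported functions in `W^{1,p}(Ω)` belong to `W_0^{1,p}(Ω)`. -/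
theorem MemW1p.memW1pZero_of_ae_eq_zero (hΩ : IsOpen Ω) (hp : 1 < p) (hw : MemW1p Ω p w)
    {K : Set (EuclideanSpace ℝ (Fin d))} (hK : IsCompact K) (hKΩ : K ⊆ Ω)
    (hw0 : ∀ᵐ x ∂(volume.restrict Ω), x ∉ K → w x = 0) : MemW1pZero Ω p w := by
  obtain ⟨G, hG, hGp⟩ := hw.2
  have ew : w =ᵐ[volume.restrict Ω] K.indicator w := by
    filter_upwards [hw0] with x hx
    by_cases hxK : x ∈ K
    · rw [indicator_of_mem hxK]
    · rw [indicator_of_notMem hxK, hx hxK]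
  -- Off `K` the function vanishes, hence so does its gradient a.e. Passing to indicators makes both
  -- vanish at every point off `K`, as the approximation lemma requires.
  have eG : G =ᵐ[volume.restrict Ω] K.indicator G := by
    filter_upwards [hw0, hG.ae_eq_zero_of_eq_zero hΩ] with x hx hx'
    by_cases hxK : x ∈ K
    · rw [indicator_of_mem hxK]
    · rw [indicator_of_notMem hxK, hx' (hx hxK)]
  have hwK : MemLp (K.indicator w) (ENNReal.ofReal p) :=
    (memLp_indicator_iff_restrict hK.measurableSet).2
      (hw.1.mono_measure (Measure.restrict_mono hKΩ le_rfl))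
  have hGK : MemLp (K.indicator G) (ENNReal.ofReal p) :=
    (memLp_indicator_iff_restrict hK.measurableSet).2
      (hGp.mono_measure (Measure.restrict_mono hKΩ le_rfl))
  refine ⟨hw, fun ε hε => ?_⟩
  obtain ⟨ψ, hψ, h1, h2⟩ := (hG.congr ew eG).exists_isTestFunction_approx hΩ
    (one_le_ofReal_of_one_lt hp) ENNReal.ofReal_ne_top hK hKΩ
    (fun x hx => indicator_of_notMem hx _) (fun x hx => indicator_of_notMem hx _) hwK hGK hε.ne'
  rw [eLpNorm_sub_comm] at h1 h2
  refine ⟨ψ, hψ, (eLpNorm_congr_ae ?_).trans_le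
      ((eLpNorm_mono_measure _ Measure.restrict_le_self).trans h1),
    (eLpNorm_congr_ae ?_).trans_le ((eLpNorm_mono_measure _ Measure.restrict_le_self).trans h2)⟩
  · filter_upwards [ew] with x hx
    rw [Pi.sub_apply, ← hx]
  · filter_upwards [eG, hG.weakGradient_ae_eq hΩ] with x hx hx'
    rw [Pi.sub_apply, ← hx, hx']

theorem MemW1pZero.add (hΩ : IsOpen Ω) (hp : 1 < p) (hu : MemW1pZero Ω p u)
    (hw : MemW1pZero Ω p w) : MemW1pZero Ω p (fun x => u x + w x) := by
  refine ⟨hu.1.add hw.1, fun ε hε => ?_⟩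
  have hε2 : 0 < ε / 2 := ENNReal.half_pos hε.ne'
  obtain ⟨φ, hφ, h1, h2⟩ := hu.2 _ hε2
  obtain ⟨ψ, hψ, h3, h4⟩ := hw.2 _ hε2
  refine ⟨_, hφ.add hψ, ?_, ?_⟩
  · calc _ = eLpNorm ((fun x => u x - φ x) + fun x => w x - ψ x) (ENNReal.ofReal p)
          (volume.restrict Ω) := by congr 1; ext x; simp only [Pi.add_apply]; ring
      _ ≤ _ := eLpNorm_add_le (hu.1.1.sub (hφ.memLp _ _)).aestronglyMeasurable
          (hw.1.1.sub (hψ.memLp _ _)).aestronglyMeasurable (one_le_ofReal_of_one_lt hp)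
      _ ≤ ε / 2 + ε / 2 := add_le_add h1 h3
      _ = ε := ENNReal.add_halves ε
  · calc _ = eLpNorm ((fun x => weakGradient Ω u x - gradient φ x) +
          fun x => weakGradient Ω w x - gradient ψ x) (ENNReal.ofReal p)
          (volume.restrict Ω) := by
          refine eLpNorm_congr_ae ?_
          filter_upwards [(hu.1.hasWeakGradient.add hw.1.hasWeakGradient).weakGradient_ae_eq hΩ]
            with x hx
          rw [hx, hφ.gradient_add hψ, Pi.add_apply]; abel
      _ ≤ _ := eLpNorm_add_le
          ((hu.1.memLp_weakGradient hΩ).sub (hφ.memLp_gradient _ _)).aestronglyMeasurable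
          ((hw.1.memLp_weakGradient hΩ).sub (hψ.memLp_gradient _ _)).aestronglyMeasurable
          (one_le_ofReal_of_one_lt hp)
      _ ≤ ε / 2 + ε / 2 := add_le_add h2 h4
      _ = ε := ENNReal.add_halves ε

end Sobolev

/-! ### First variation of the `p`-energy. -/

/-- If `t ↦ ∫ ‖G + tΦ‖^p` does not drop below its value at `0` for `t > 0`, then its derivative
at `0` is nonnegative. -/
theorem integral_norm_rpow_mul_inner_nonneg {α E : Type*} [MeasurableSpace α] {μ : Measure α}
    [NormedAddCommGroup E] [InnerProductSpace ℝ E] {p : ℝ} (hp : 1 < p) {G Φ : α → E}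
    (hG : MemLp G (ENNReal.ofReal p) μ) (hΦ : MemLp Φ (ENNReal.ofReal p) μ)
    (hmin : ∀ t : ℝ, 0 < t → ∫ x, ‖G x‖ ^ p ∂μ ≤ ∫ x, ‖G x + t • Φ x‖ ^ p ∂μ) :
    0 ≤ ∫ x, ‖G x‖ ^ (p - 2) * inner ℝ (G x) (Φ x) ∂μ := by
  have hp0 : 0 < p := zero_lt_one.trans hp
  have hint : ∀ {f : α → ℝ}, MemLp f (ENNReal.ofReal p) μ →
      Integrable (fun x => ‖f x‖ ^ p) μ := fun hf => by
    have := hf.integrable_norm_rpow (by simpa using hp0) ENNReal.ofReal_ne_top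
    rwa [ENNReal.toReal_ofReal hp0.le] at this
  have hmeas : ∀ t : ℝ, AEStronglyMeasurable (fun x => G x + t • Φ x) μ := fun t =>
    hG.aestronglyMeasurable.add (hΦ.aestronglyMeasurable.const_smul t)
  -- Differentiation under the integral: for `|t| < 1` the derivative is dominated by `p (‖G‖ +
  -- ‖Φ‖)^p`, integrable since both fields lie in `L^p`.
  have hder := (hasDerivAt_integral_of_dominated_loc_of_deriv_le (μ := μ) (x₀ := (0 : ℝ))
    (s := ball 0 1) (F := fun t x => ‖G x + t • Φ x‖ ^ p)
    (F' := fun t x => p * (‖G x + t • Φ x‖ ^ (p - 2) * inner ℝ (G x + t • Φ x) (Φ x)))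
    (bound := fun x => p * ‖‖G x‖ + ‖Φ x‖‖ ^ p) (ball_mem_nhds _ one_pos)
    (Eventually.of_forall fun t => ((hmeas t).norm.aemeasurable.pow_const p).aestronglyMeasurable)
    ?_ ?_ ?_ ((hint (hG.norm.add hΦ.norm)).const_mul p) ?_).2
  · have hlim := hder.tendsto_slope_zero_right
    have hnn : 0 ≤ ∫ x, p * (‖G x + (0 : ℝ) • Φ x‖ ^ (p - 2) *
        inner ℝ (G x + (0 : ℝ) • Φ x) (Φ x)) ∂μ := by
      refine ge_of_tendsto hlim ?_
      filter_upwards [self_mem_nhdsWithin] with t ht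
      have ht : 0 < t := ht
      have := hmin t ht
      simp only [zero_add, zero_smul, add_zero, smul_eq_mul]
      exact mul_nonneg (inv_nonneg.2 ht.le) (sub_nonneg.2 this)
    simp only [zero_smul, add_zero] at hnn
    rw [integral_const_mul] at hnn
    exact nonneg_of_mul_nonneg_right hnn hp0
  · simpa using hint hG.norm
  · exact ((((hmeas 0).norm.aemeasurable.pow_const _).aestronglyMeasurable.mul
      ((hmeas 0).inner hΦ.aestronglyMeasurable)).const_mul p)
  · refine Eventually.of_forall fun x t ht => ?_
    have ht1 : |t| ≤ 1 := by simpa using (mem_ball.1 ht).le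
    have hle : ‖G x + t • Φ x‖ ≤ ‖G x‖ + ‖Φ x‖ := by
      refine (norm_add_le _ _).trans (add_le_add_right ?_ _)
      rw [norm_smul]
      exact mul_le_of_le_one_left (norm_nonneg _) ht1
    set z := G x + t • Φ x
    rw [norm_mul, Real.norm_of_nonneg hp0.le, norm_mul,
      Real.norm_of_nonneg (Real.rpow_nonneg (norm_nonneg z) _),
      Real.norm_of_nonneg (add_nonneg (norm_nonneg (G x)) (norm_nonneg (Φ x)))]
    refine mul_le_mul_of_nonneg_left ?_ hp0.le
    -- When `z = 0` the inner product vanishes, whatever the sign of `p - 2`. Otherwise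
    -- Cauchy–Schwarz raises the exponent to `p - 1 > 0`, where the power is monotone.
    rcases (norm_nonneg z).eq_or_lt with hz | hz
    · rw [norm_eq_zero.1 hz.symm]
      simp only [inner_zero_left, norm_zero, mul_zero]
      positivity
    · calc ‖z‖ ^ (p - 2) * ‖inner ℝ z (Φ x)‖ ≤ ‖z‖ ^ (p - 2) * (‖z‖ * ‖Φ x‖) := by
            gcongr; exact norm_inner_le_norm _ _
        _ = ‖z‖ ^ (p - 1) * ‖Φ x‖ := by
            rw [← mul_assoc, ← Real.rpow_add_one hz.ne']; congr 2; ring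
        _ ≤ (‖G x‖ + ‖Φ x‖) ^ (p - 1) * (‖G x‖ + ‖Φ x‖) := by
            gcongr
            exact le_add_of_nonneg_left (norm_nonneg _)
        _ = (‖G x‖ + ‖Φ x‖) ^ p := by
            rw [← Real.rpow_add_one (hz.trans_le hle).ne']; congr 1; ring
  · refine Eventually.of_forall fun x t _ => ?_
    have h1 : HasDerivAt (fun t : ℝ => G x + t • Φ x) (Φ x) t := by
      simpa using ((hasDerivAt_id t).smul_const (Φ x)).const_add (G x)
    have h2 := (hasFDerivAt_norm_rpow (G x + t • Φ x) hp).comp_hasDerivAt t h1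
    refine h2.congr_deriv ?_
    exact mul_assoc _ _ _

/-! ### Pointwise algebra of segregated tuples. -/

section Segregation

variable {k : ℕ}

/-- Segregated nonnegative values: either all entries off `i` vanish, or exactly one entry `l ≠ i`
is positive and all the others vanish. -/
theorem segregated_cases (i : Fin k) {a : Fin k → ℝ} (ha : ∀ j, 0 ≤ a j)
    (hseg : ∀ j l, j ≠ l → a j * a l = 0) :
    (∀ j, j ≠ i → a j = 0) ∨ ∃ l, l ≠ i ∧ 0 < a l ∧ ∀ j, j ≠ l → a j = 0 := by
  by_cases h : ∀ j, j ≠ i → a j = 0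
  · exact Or.inl h
  · push Not at h
    obtain ⟨l, hli, hl⟩ := h
    exact Or.inr ⟨l, hli, (ha l).lt_of_ne' hl,
      fun j hj => (mul_eq_zero.1 (hseg j l hj)).resolve_right hl⟩

theorem sub_sum_erase_of_eq_zero {M : Type*} [AddCommGroup M] {i : Fin k} {f : Fin k → M}
    (h : ∀ j, j ≠ i → f j = 0) : f i - ∑ j ∈ Finset.univ.erase i, f j = f i := by
  rw [Finset.sum_eq_zero fun j hj => h j (Finset.ne_of_mem_erase hj), sub_zero]

theorem sub_sum_erase_of_single {M : Type*} [AddCommGroup M] {i l : Fin k} (hli : l ≠ i)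
    {f : Fin k → M} (h : ∀ j, j ≠ l → f j = 0) :
    f i - ∑ j ∈ Finset.univ.erase i, f j = -f l := by
  rw [Finset.sum_eq_single_of_mem l (Finset.mem_erase.2 ⟨hli, Finset.mem_univ _⟩)
    fun j _ hj => h j hj, h i hli.symm, zero_sub]

variable {E : Type*} [NormedAddCommGroup E] {p : ℝ} {i : Fin k} {a : Fin k → ℝ} {g : Fin k → E}

/-- At most one `a j` is nonzero, and gradients vanish with the values, so both sides reduce to a
single `‖g j‖ ^ p`; the sign in the hat combination is invisible to the norm. -/
theorem sum_norm_rpow_eq_of_segregated (hp : 0 < p) (ha : ∀ j, 0 ≤ a j)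
    (hseg : ∀ j l, j ≠ l → a j * a l = 0) (hg : ∀ j, a j = 0 → g j = 0) :
    ∑ j, ‖g j‖ ^ p = ‖g i - ∑ j ∈ Finset.univ.erase i, g j‖ ^ p := by
  rcases segregated_cases i ha hseg with h | ⟨l, hli, -, h⟩
  · rw [sub_sum_erase_of_eq_zero fun j hj => hg j (h j hj),
      Finset.sum_eq_single i (fun j _ hj => by
        rw [hg j (h j hj), norm_zero, Real.zero_rpow hp.ne']) (by simp)]
  · rw [sub_sum_erase_of_single hli fun j hj => hg j (h j hj), norm_neg,
      Finset.sum_eq_single l (fun j _ hj => by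
        rw [hg j (h j hj), norm_zero, Real.zero_rpow hp.ne']) (by simp)]

/-- The sign of the perturbed hat value selects the one surviving component: the `i`-th if positive,
the formerly positive `l`-th if negative. On a tie every component is cut off, and `hW` makes the
right side vanish too. -/
theorem sum_norm_rpow_competitor (hp : 0 < p) (ha : ∀ j, 0 ≤ a j)
    (hseg : ∀ j l, j ≠ l → a j * a l = 0) (hg : ∀ j, a j = 0 → g j = 0) {s : ℝ} (hs : 0 ≤ s)
    {Φ : E} (hW : a i - ∑ j ∈ Finset.univ.erase i, a j + s = 0 →
      g i - ∑ j ∈ Finset.univ.erase i, g j + Φ = 0) :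
    ∑ j, ‖if j = i then
        if 0 < a i - ∑ j ∈ Finset.univ.erase i, a j + s then
          g i - ∑ j ∈ Finset.univ.erase i, g j + Φ else 0
      else if 0 < a j - s then g j - Φ else 0‖ ^ p =
      ‖g i - ∑ j ∈ Finset.univ.erase i, g j + Φ‖ ^ p := by
  rcases segregated_cases i ha hseg with h | ⟨l, hli, hl, h⟩
  · rw [Finset.sum_eq_single i (fun j _ hj => by
      rw [if_neg hj, h j hj, if_neg (by linarith), norm_zero, Real.zero_rpow hp.ne']) (by simp),
      if_pos rfl]
    split_ifs with h0
    · rfl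
    · rw [hW]
      rw [sub_sum_erase_of_eq_zero h] at h0 ⊢
      linarith [ha i]
  · rw [sub_sum_erase_of_single hli h, sub_sum_erase_of_single hli fun j hj => hg j (h j hj)] at *
    rcases lt_trichotomy 0 (-a l + s) with h0 | h0 | h0
    · rw [Finset.sum_eq_single i (fun j _ hj => ?_) (by simp), if_pos rfl, if_pos h0]
      rw [if_neg hj, if_neg, norm_zero, Real.zero_rpow hp.ne']
      rcases eq_or_ne j l with rfl | hjl
      · linarith
      · rw [h j hjl]; linarith
    · rw [hW h0.symm, norm_zero, Real.zero_rpow hp.ne']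
      refine Finset.sum_eq_zero fun j _ => ?_
      rcases eq_or_ne j i with rfl | hj
      · simp [hp.ne']
      · rw [if_neg hj, if_neg, norm_zero, Real.zero_rpow hp.ne']
        rcases eq_or_ne j l with rfl | hjl
        · linarith
        · rw [h j hjl]; linarith
    · rw [Finset.sum_eq_single l (fun j _ hj => ?_) (by simp), if_neg hli,
        if_pos (by linarith), ← norm_neg, neg_sub, sub_eq_neg_add]
      rcases eq_or_ne j i with rfl | hji
      · rw [if_pos rfl, if_neg h0.not_gt, norm_zero, Real.zero_rpow hp.ne']
      · rw [if_neg hji, if_neg (by rw [h j hj]; linarith), norm_zero, Real.zero_rpow hp.ne']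

/-- If `a j > s ≥ 0`, all other entries vanish and the perturbed hat value is `s - a j < 0`;
otherwise the second factor is zero. -/
theorem hat_mul_competitor_eq_zero (hseg : ∀ j l, j ≠ l → a j * a l = 0)
    {s : ℝ} (hs : 0 ≤ s) {j : Fin k} (hj : j ≠ i) :
    max (a i - ∑ j ∈ Finset.univ.erase i, a j + s) 0 * max (a j - s) 0 = 0 := by
  rcases le_or_gt (a j) s with h | h
  · rw [max_eq_right (by linarith : a j - s ≤ 0), mul_zero]
  · have hz : ∀ l, l ≠ j → a l = 0 := fun l hl =>
      (mul_eq_zero.1 (hseg l j hl)).resolve_right (hs.trans_lt h).ne'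
    rw [sub_sum_erase_of_single hj hz, max_eq_right (by linarith), zero_mul]

/-- This makes the `i`-th competitor coincide with `u i` where the test function vanishes. -/
theorem max_hat_zero_eq (ha : ∀ j, 0 ≤ a j) (hseg : ∀ j l, j ≠ l → a j * a l = 0) :
    max (a i - ∑ j ∈ Finset.univ.erase i, a j) 0 = a i := by
  rcases segregated_cases i ha hseg with h | ⟨l, hli, hl, h⟩
  · rw [sub_sum_erase_of_eq_zero h, max_eq_left (ha i)]
  · rw [sub_sum_erase_of_single hli h, h i hli.symm, max_eq_right (by linarith)]

end Segregation

/-! ### Competitors and the two differential inequalities. -/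

section Minimizers

variable {d k : ℕ} {Ω : Set (EuclideanSpace ℝ (Fin d))} {p : ℝ}
  {g u v : Fin k → EuclideanSpace ℝ (Fin d) → ℝ}

/-- A segregated tuple that differs from an admissible one only on a compact subset is
admissible. -/
theorem mem_segregatedClass_of_eq_off_compact (hΩ : IsOpen Ω) (hp : 1 < p)
    (hu : u ∈ segregatedClass Ω p g) (hv : ∀ i, MemW1p Ω p (v i))
    (hv0 : ∀ i, ∀ᵐ x ∂(volume.restrict Ω), 0 ≤ v i x)
    (hvs : ∀ i j, i ≠ j → ∀ᵐ x ∂(volume.restrict Ω), v i x * v j x = 0)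
    {K : Set (EuclideanSpace ℝ (Fin d))} (hK : IsCompact K) (hKΩ : K ⊆ Ω)
    (heq : ∀ i, ∀ᵐ x ∂(volume.restrict Ω), x ∉ K → v i x = u i x) :
    v ∈ segregatedClass Ω p g := by
  refine ⟨hv, hv0, hvs, fun i => ?_⟩
  have h1 : MemW1pZero Ω p (fun x => v i x - u i x) :=
    ((hv i).sub (hu.1 i)).memW1pZero_of_ae_eq_zero hΩ hp hK hKΩ <| by
      filter_upwards [heq i] with x hx hxK
      rw [hx hxK, sub_self]
  -- `v i - g i = (v i - u i) + (u i - g i)`.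
  simpa using h1.add hΩ hp (hu.2.2.2 i)

theorem integral_le_of_isMinOn (hp : 0 < p)
    (hmin : IsMinOn (segregationEnergy Ω p) (segregatedClass Ω p g) u)
    (hv : v ∈ segregatedClass Ω p g) :
    ∫ x in Ω, ∑ i, ‖weakGradient Ω (u i) x‖ ^ p ≤
      ∫ x in Ω, ∑ i, ‖weakGradient Ω (v i) x‖ ^ p :=
  le_of_mul_le_mul_left (hmin hv) (one_div_pos.2 hp)

theorem ae_segregated (hu : u ∈ segregatedClass Ω p g) :
    ∀ᵐ x ∂(volume.restrict Ω), (∀ j, 0 ≤ u j x) ∧ ∀ j l, j ≠ l → u j x * u l x = 0 := by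
  have h2 : ∀ᵐ x ∂(volume.restrict Ω), ∀ j l, j ≠ l → u j x * u l x = 0 :=
    ae_all_iff.2 fun j => ae_all_iff.2 fun l => by
      by_cases h : j = l
      · exact Eventually.of_forall fun x h' => (h' h).elim
      · filter_upwards [hu.2.2.1 j l h] with x hx _ using hx
  exact (ae_all_iff.2 hu.2.1).and h2

theorem isWeaklyPSubharmonic_of_isMinOn (hΩ : IsOpen Ω) (hp : 1 < p)
    (hu : u ∈ segregatedClass Ω p g)
    (hmin : IsMinOn (segregationEnergy Ω p) (segregatedClass Ω p g) u) (i : Fin k) :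
    IsWeaklyPSubharmonic Ω p (u i) := by
  refine ⟨hu.1 i, fun φ hφ hφ0 => ?_⟩
  have hp0 : 0 < p := zero_lt_one.trans hp
  -- The variation is taken in the direction `-∇φ`, which reverses the sign of the conclusion.
  have key := integral_norm_rpow_mul_inner_nonneg hp ((hu.1 i).memLp_weakGradient hΩ)
    (hφ.memLp_gradient (ENNReal.ofReal p) (volume.restrict Ω)).neg fun t ht => ?_
  · simp only [Pi.neg_apply, inner_neg_right, mul_neg, integral_neg] at key
    exact neg_nonneg.1 key
  have htφ := hφ.const_mul t
  have hw : MemW1p Ω p (fun x => u i x - t * φ x) := (hu.1 i).sub htφ.memW1p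
  let v : Fin k → EuclideanSpace ℝ (Fin d) → ℝ :=
    Function.update u i (fun x => max (u i x - t * φ x) 0)
  have hvi : v i = fun x => max (u i x - t * φ x) 0 := Function.update_self ..
  have hvj : ∀ j, j ≠ i → v j = u j := fun j hj => Function.update_of_ne hj ..
  have hvle : ∀ j x, 0 ≤ u j x → 0 ≤ v j x ∧ v j x ≤ u j x := fun j x h0 => by
    rcases eq_or_ne j i with rfl | hj
    · rw [hvi]
      exact ⟨le_max_right _ _, max_le (by nlinarith [hφ0 x]) h0⟩
    · rw [hvj j hj]
      exact ⟨h0, le_rfl⟩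
  have hv : v ∈ segregatedClass Ω p g := by
    refine mem_segregatedClass_of_eq_off_compact hΩ hp hu (fun j => ?_) (fun j => ?_)
      (fun j l hjl => ?_) hφ.2.1.isCompact hφ.2.2 fun j => ?_
    · rcases eq_or_ne j i with rfl | hj
      · rw [hvi]
        exact hw.posPart hΩ
      · rw [hvj j hj]
        exact hu.1 j
    · filter_upwards [hu.2.1 j] with x hx using (hvle j x hx).1
    · filter_upwards [hu.2.1 j, hu.2.1 l, hu.2.2.1 j l hjl] with x hj hl h0
      obtain ⟨h1, h2⟩ := hvle j x hj
      obtain ⟨h3, h4⟩ := hvle l x hl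
      exact le_antisymm ((mul_le_mul h2 h4 h3 hj).trans_eq h0) (mul_nonneg h1 h3)
    · filter_upwards [hu.2.1 j] with x hx hxK
      rcases eq_or_ne j i with rfl | hj
      · simp only [hvi, image_eq_zero_of_notMem_tsupport hxK, mul_zero, sub_zero, max_eq_left hx]
      · rw [hvj j hj]
  have hle := integral_le_of_isMinOn hp0 hmin hv
  have hint : ∀ {z : Fin k → EuclideanSpace ℝ (Fin d) → ℝ}, z ∈ segregatedClass Ω p g → ∀ j,
      Integrable (fun x => ‖weakGradient Ω (z j) x‖ ^ p) (volume.restrict Ω) :=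
    fun hz j => (hz.1 j).integrable_norm_weakGradient_rpow hΩ hp
  have hsum : ∑ j ∈ Finset.univ.erase i, ∫ x in Ω, ‖weakGradient Ω (v j) x‖ ^ p =
      ∑ j ∈ Finset.univ.erase i, ∫ x in Ω, ‖weakGradient Ω (u j) x‖ ^ p :=
    Finset.sum_congr rfl fun j hj => by rw [hvj j (Finset.ne_of_mem_erase hj)]
  rw [integral_finsetSum _ fun j _ => hint hu j, integral_finsetSum _ fun j _ => hint hv j,
    ← Finset.add_sum_erase _ _ (Finset.mem_univ i), ← Finset.add_sum_erase _ _ (Finset.mem_univ i),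
    hsum] at hle
  refine (le_of_add_le_add_right hle).trans ?_
  have hG := (hu.1 i).hasWeakGradient.sub htφ.hasWeakGradient
  have hwint := hw.integrable_norm_weakGradient_rpow hΩ hp
  have hwG := hG.weakGradient_ae_eq hΩ
  have hnorm : (fun x => ‖weakGradient Ω (fun x => u i x - t * φ x) x‖ ^ p)
      =ᵐ[volume.restrict Ω] fun x => ‖weakGradient Ω (u i) x + t • (-gradient φ) x‖ ^ p := by
    filter_upwards [hwG] with x hx
    rw [hx, hφ.gradient_const_mul, Pi.neg_apply, smul_neg, sub_eq_add_neg]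
  rw [← integral_congr_ae hnorm]
  -- Truncation only lowers the energy: the gradient of a positive part is either the original
  -- gradient or zero.
  refine integral_mono_ae (hint hv i) hwint ?_
  filter_upwards [(hw.hasWeakGradient.posPart hΩ).weakGradient_ae_eq hΩ] with x hx
  rw [hvi, hx]
  split_ifs
  · exact le_rfl
  · rw [norm_zero, Real.zero_rpow hp0.ne']
    positivity

theorem isWeaklyPSuperharmonic_hatComponent_of_isMinOn (hΩ : IsOpen Ω) (hp : 1 < p)
    (hu : u ∈ segregatedClass Ω p g)
    (hmin : IsMinOn (segregationEnergy Ω p) (segregatedClass Ω p g) u) (i : Fin k) :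
    IsWeaklyPSuperharmonic Ω p (hatComponent u i) := by
  have hp0 : 0 < p := zero_lt_one.trans hp
  have hhat : MemW1p Ω p (hatComponent u i) :=
    (hu.1 i).sub (MemW1p.sum _ fun j _ => hu.1 j)
  have hhatG : weakGradient Ω (hatComponent u i) =ᵐ[volume.restrict Ω] fun x =>
      weakGradient Ω (u i) x - ∑ j ∈ Finset.univ.erase i, weakGradient Ω (u j) x :=
    ((hu.1 i).hasWeakGradient.sub
      (HasWeakGradient.sum _ fun j _ => (hu.1 j).hasWeakGradient)).weakGradient_ae_eq hΩ
  refine ⟨hhat, fun φ hφ hφ0 => integral_norm_rpow_mul_inner_nonneg hp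
    (hhat.memLp_weakGradient hΩ) (hφ.memLp_gradient _ _) fun t ht => ?_⟩
  have htφ := hφ.const_mul t
  have hw : MemW1p Ω p (fun x => hatComponent u i x + t * φ x) := hhat.add htφ.memW1p
  have hm : ∀ j, MemW1p Ω p (fun x => u j x - t * φ x) := fun j => (hu.1 j).sub htφ.memW1p
  -- Up to null sets, component `i` is the positive part of `û + tφ`, and the other components sum
  -- to its negative part.
  let v : Fin k → EuclideanSpace ℝ (Fin d) → ℝ := fun j =>
    if j = i then fun x => max (hatComponent u i x + t * φ x) 0
    else fun x => max (u j x - t * φ x) 0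
  have hvi : v i = fun x => max (hatComponent u i x + t * φ x) 0 := if_pos rfl
  have hvj : ∀ j, j ≠ i → v j = fun x => max (u j x - t * φ x) 0 := fun j hj => if_neg hj
  have htφ0 : ∀ x, 0 ≤ t * φ x := fun x => mul_nonneg ht.le (hφ0 x)
  have hv : v ∈ segregatedClass Ω p g := by
    refine mem_segregatedClass_of_eq_off_compact hΩ hp hu (fun j => ?_) (fun j => ?_)
      (fun j l hjl => ?_) hφ.2.1.isCompact hφ.2.2 fun j => ?_
    · rcases eq_or_ne j i with rfl | hj
      · rw [hvi]
        exact hw.posPart hΩ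
      · rw [hvj j hj]
        exact (hm j).posPart hΩ
    · refine Eventually.of_forall fun x => ?_
      rcases eq_or_ne j i with rfl | hj
      · rw [hvi]
        exact le_max_right _ _
      · rw [hvj j hj]
        exact le_max_right _ _
    · filter_upwards [ae_segregated hu] with x hx
      rcases eq_or_ne j i with rfl | hj
      · rw [hvi, hvj l hjl.symm]
        exact hat_mul_competitor_eq_zero hx.2 (htφ0 x) hjl.symm
      · rcases eq_or_ne l i with rfl | hl
        · rw [hvi, hvj j hj, mul_comm]
          exact hat_mul_competitor_eq_zero hx.2 (htφ0 x) hj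
        · simp only [hvj j hj, hvj l hl]
          rcases mul_eq_zero.1 (hx.2 j l hjl) with h | h
          · rw [h, max_eq_right (by linarith [htφ0 x]), zero_mul]
          · rw [h, max_eq_right (by linarith [htφ0 x] : (0 : ℝ) - t * φ x ≤ 0), mul_zero]
    · filter_upwards [ae_segregated hu] with x hx hxK
      rcases eq_or_ne j i with rfl | hj
      · simp only [hvi, image_eq_zero_of_notMem_tsupport hxK, mul_zero, add_zero]
        exact max_hat_zero_eq hx.1 hx.2
      · simp only [hvj j hj, image_eq_zero_of_notMem_tsupport hxK, mul_zero, sub_zero,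
          max_eq_left (hx.1 j)]
  have hle := integral_le_of_isMinOn hp0 hmin hv
  have hzero : ∀ᵐ x ∂(volume.restrict Ω), ∀ j, u j x = 0 → weakGradient Ω (u j) x = 0 :=
    ae_all_iff.2 fun j => (hu.1 j).hasWeakGradient.ae_eq_zero_of_eq_zero hΩ
  have hw' := hhat.hasWeakGradient.add htφ.hasWeakGradient
  have hvG : ∀ᵐ x ∂(volume.restrict Ω), ∀ j, weakGradient Ω (v j) x =
      if j = i then
        if 0 < hatComponent u i x + t * φ x then
          weakGradient Ω (hatComponent u i) x + t • gradient φ x else 0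
      else if 0 < u j x - t * φ x then weakGradient Ω (u j) x - t • gradient φ x else 0 := by
    refine ae_all_iff.2 fun j => ?_
    rcases eq_or_ne j i with rfl | hj
    · filter_upwards [(hw'.posPart hΩ).weakGradient_ae_eq hΩ] with x hx
      rw [hvi, hx, if_pos rfl, hφ.gradient_const_mul]
    · filter_upwards [(((hu.1 j).hasWeakGradient.sub htφ.hasWeakGradient).posPart
        hΩ).weakGradient_ae_eq hΩ] with x hx
      rw [hvj j hj, hx, if_neg hj, hφ.gradient_const_mul]
  have e1 : ∫ x in Ω, ∑ j, ‖weakGradient Ω (u j) x‖ ^ p =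
      ∫ x in Ω, ‖weakGradient Ω (hatComponent u i) x‖ ^ p := by
    refine integral_congr_ae ?_
    filter_upwards [ae_segregated hu, hzero, hhatG] with x hx h0 hG
    rw [hG]
    exact sum_norm_rpow_eq_of_segregated hp0 hx.1 hx.2 h0
  -- An exact identity rather than an inequality: the competitor carries the whole gradient of `û +
  -- tφ`, except on its zero set, where that gradient vanishes a.e.
  have e2 : ∫ x in Ω, ∑ j, ‖weakGradient Ω (v j) x‖ ^ p =
      ∫ x in Ω, ‖weakGradient Ω (hatComponent u i) x + t • gradient φ x‖ ^ p := by
    refine integral_congr_ae ?_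
    filter_upwards [ae_segregated hu, hzero, hhatG, hvG, hw'.ae_eq_zero_of_eq_zero hΩ]
      with x hx h0 hG hv hW
    simp only [hv]
    rw [hφ.gradient_const_mul] at hW
    rw [hG] at hW ⊢
    exact sum_norm_rpow_competitor hp0 hx.1 hx.2 h0 (htφ0 x) hW
  rwa [e1, e2] at hle

end Minimizers

theorem lemma1 {d k : ℕ} (Ω : Set (EuclideanSpace ℝ (Fin d))) (hΩ : IsOpen Ω)
    (p : ℝ) (hp : 1 < p)
    (g u : Fin k → EuclideanSpace ℝ (Fin d) → ℝ)
    (hu : u ∈ segregatedClass Ω p g)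
    (hmin : IsMinOn (segregationEnergy Ω p) (segregatedClass Ω p g) u) :
    (∀ i, IsWeaklyPSubharmonic Ω p (u i)) ∧
      ∀ i, IsWeaklyPSuperharmonic Ω p (hatComponent u i) :=
  ⟨isWeaklyPSubharmonic_of_isMinOn hΩ hp hu hmin,
    isWeaklyPSuperharmonic_hatComponent_of_isMinOn hΩ hp hu hmin⟩
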